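/- Let $(M,g)$ be a connected smooth $n$-dimensional Riemannian manifold with tangent bundle $TM$. Let $c_1,c_2,c_3,d_1,d_2,d_3:[0,\infty)\to\mathbb R$ be smooth functions, and let $G$ be the general natural lifted metric on $TM$ that they define: in the coordinates $(x^i,y^i)$ of $TM$ induced by a local chart of $M$, with $\frac{\delta}{\delta x^i}=\frac{\partial}{\partial x^i}-y^k\Gamma^h_{ki}\frac{\partial}{\partial y^h}$ ($\Gamma^h_{ki}$ the Christoffel symbols of $g$), $g_{0i}=y^kg_{ki}$ and $t=\frac12 g_{ik}y^iy^k$, $$G\Big(\frac{\delta}{\delta x^i},\frac{\delta}{\delta x^j}\Big)=c_1(t)g_{ij}+d_1(t)g_{0i}g_{0j},\qquad G\Big(\frac{\partial}{\partial y^i},\frac{\partial}{\partial y^j}\Big)=c_2(t)g_{ij}+d_2(t)g_{0i}g_{0j},$$ $$G\Big(\frac{\partial}{\partial y^i},\frac{\delta}{\delta x^j}\Big)=G\Big(\frac{\delta}{\delta x^i},\frac{\partial}{\partial y^j}\Big)=c_3(t)g_{ij}+d_3(t)g_{0i}g_{0j}.$$ Assume that $G$ is nondegenerate (it need not be positive definite).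 Suppose that $(TM,G)$ is conformally flat, that is, around each point of $TM$ there is a smooth positive function $\rho$ such that $\rho^2G$ is locally isometric to a (pseudo-)Euclidean space. Then $(M,g)$ has constant sectional curvature: there is a constant $c\in\mathbb R$ such that every tangent plane of $M$ has sectional curvature $c$, and in every local chart of $M$ the curvature tensor of $g$ is $$R^h_{kij}=c\,(g_{jk}\delta^h_i-g_{ik}\delta^h_j),\qquad\text{where } R\Big(\frac{\partial}{\partial x^i},\frac{\partial}{\partial x^j}\Big)\frac{\partial}{\partial x^k}=R^h_{kij}\frac{\partial}{\partial x^h}.$$ -/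

import Mathlib

open scoped Manifold ContDiff

noncomputable section

namespace NaturalLift

/-- The coordinate space of local charts of an `n`-dimensional manifold. -/
abbrev Coord (n : ℕ) : Type := EuclideanSpace ℝ (Fin n)

/-- A smooth Riemannian metric on a smooth `n`-dimensional manifold `M`. -/
abbrev SmoothMetric (n : ℕ) (M : Type*) [TopologicalSpace M] [ChartedSpace (Coord n) M]
    [IsManifold (𝓡 n) ∞ M] : Type _ :=
  Bundle.ContMDiffRiemannianMetric (𝓡 n) ∞ (Coord n) (TangentSpace (𝓡 n) : M → Type)

/-! ### Riemannian geometry in one coordinate system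

Here `g : Coord n → Matrix (Fin n) (Fin n) ℝ` is the matrix `(g_{ij})` of a metric as a function
of the coordinates `x = (x¹, …, xⁿ)`. -/

section Coordinates

variable {n : ℕ}

/-- The `i`-th partial derivative of a function of the coordinates. -/
def partialDeriv (i : Fin n) (f : Coord n → ℝ) (x : Coord n) : ℝ :=
  fderiv ℝ f x (EuclideanSpace.single i 1)

/-- The value `g_{ij} vⁱ wʲ` at the point `x`. -/
def form (g : Coord n → Matrix (Fin n) (Fin n) ℝ) (x v w : Coord n) : ℝ :=
  ∑ i, ∑ j, g x i j * v i * w j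

/-- The Christoffel symbol `Γ^h_{ij}` of the Levi-Civita connection of `g`. -/
def christoffel (g : Coord n → Matrix (Fin n) (Fin n) ℝ) (x : Coord n) (h i j : Fin n) : ℝ :=
  (1 / 2) * ∑ k, (g x)⁻¹ h k *
    (partialDeriv i (fun z => g z j k) x + partialDeriv j (fun z => g z i k) x
      - partialDeriv k (fun z => g z i j) x)

/-- The component `R^h_{kij}` of the curvature tensor
`R(X, Y)Z = ∇_X ∇_Y Z - ∇_Y ∇_X Z - ∇_{[X, Y]} Z`, that is, `R(∂_i, ∂_j)∂_k = R^h_{kij} ∂_h`. -/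
def riemann (g : Coord n → Matrix (Fin n) (Fin n) ℝ) (x : Coord n) (h k i j : Fin n) : ℝ :=
  partialDeriv i (fun z => christoffel g z h j k) x
    - partialDeriv j (fun z => christoffel g z h i k) x
    + ∑ l, (christoffel g x h i l * christoffel g x l j k
        - christoffel g x h j l * christoffel g x l i k)

/-- The vector `R(v, w)z` at the point `x`. -/
def curvatureVector (g : Coord n → Matrix (Fin n) (Fin n) ℝ) (x v w z : Coord n) : Coord n :=
  WithLp.toLp 2 (fun h => ∑ k, ∑ i, ∑ j, riemann g x h k i j * v i * w j * z k)

/-- The sectional curvature at `x` of the plane spanned by the linearly independent vectors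
`v` and `w`. -/
def sectionalCurvature (g : Coord n → Matrix (Fin n) (Fin n) ℝ) (x v w : Coord n) : ℝ :=
  form g x (curvatureVector g x v w w) v
    / (form g x v v * form g x w w - form g x v w ^ 2)

end Coordinates

/-! ### General natural lifted metrics on the tangent bundle -/

/-- The six coefficients of a general natural lifted metric: smooth functions on `[0, ∞)` of the
energy density. -/
structure Coefficients where
  /-- coefficient `c₁` -/
  c₁ : ℝ → ℝ
  /-- coefficient `c₂` -/
  c₂ : ℝ → ℝ
  /-- coefficient `c₃` -/
  c₃ : ℝ → ℝ
  /-- coefficient `d₁` -/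
  d₁ : ℝ → ℝ
  /-- coefficient `d₂` -/
  d₂ : ℝ → ℝ
  /-- coefficient `d₃` -/
  d₃ : ℝ → ℝ
  smooth_c₁ : ContDiffOn ℝ ∞ c₁ (Set.Ici 0)
  smooth_c₂ : ContDiffOn ℝ ∞ c₂ (Set.Ici 0)
  smooth_c₃ : ContDiffOn ℝ ∞ c₃ (Set.Ici 0)
  smooth_d₁ : ContDiffOn ℝ ∞ d₁ (Set.Ici 0)
  smooth_d₂ : ContDiffOn ℝ ∞ d₂ (Set.Ici 0)
  smooth_d₃ : ContDiffOn ℝ ∞ d₃ (Set.Ici 0)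

section Lift

variable {n : ℕ}

/-- The energy density `t = ½ g_{ik} yⁱ yᵏ` of the tangent vector with induced coordinates
`p = (x, y)`. -/
def energy (g : Coord n → Matrix (Fin n) (Fin n) ℝ) (p : Coord n × Coord n) : ℝ :=
  (1 / 2) * form g p.1 p.2 p.2

/-- The vertical components of a vector `X = (ξ, η) = ξⁱ ∂/∂xⁱ + ηʰ ∂/∂yʰ` tangent to the tangent
bundle at `p = (x, y)`: the numbers `κʰ = ηʰ + yᵏ Γ^h_{ki} ξⁱ`. With the horizontal frame
`δ/δxⁱ = ∂/∂xⁱ - yᵏ Γ^h_{ki} ∂/∂yʰ` one has `X = ξⁱ δ/δxⁱ + κʰ ∂/∂yʰ`. -/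
def verticalPart (g : Coord n → Matrix (Fin n) (Fin n) ℝ) (p X : Coord n × Coord n) : Coord n :=
  WithLp.toLp 2 (fun h => X.2 h + ∑ k, ∑ i, p.2 k * christoffel g p.1 h k i * X.1 i)

/-- `c(t) g(v, w) + d(t) g(y, v) g(y, w)` at `p = (x, y)`, where `t` is the energy density. -/
def block (g : Coord n → Matrix (Fin n) (Fin n) ℝ) (c d : ℝ → ℝ) (p : Coord n × Coord n)
    (v w : Coord n) : ℝ :=
  c (energy g p) * form g p.1 v w
    + d (energy g p) * form g p.1 p.2 v * form g p.1 p.2 w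

/-- The general natural lifted metric `G` in the induced coordinates `p = (x, y)` of the tangent
bundle, evaluated at two tangent vectors `X`, `X'` written in the frame `∂/∂xⁱ, ∂/∂yⁱ`. It is the
symmetric bilinear form with
`G(δ/δxⁱ, δ/δxʲ) = c₁ g_{ij} + d₁ g_{0i} g_{0j}`, `G(∂/∂yⁱ, ∂/∂yʲ) = c₂ g_{ij} + d₂ g_{0i} g_{0j}`,
`G(δ/δxⁱ, ∂/∂yʲ) = G(∂/∂yⁱ, δ/δxʲ) = c₃ g_{ij} + d₃ g_{0i} g_{0j}`, where `g_{0i} = yᵏ g_{ki}`. -/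
def liftedMetric (a : Coefficients) (g : Coord n → Matrix (Fin n) (Fin n) ℝ)
    (p X X' : Coord n × Coord n) : ℝ :=
  block g a.c₁ a.d₁ p X.1 X'.1
    + block g a.c₂ a.d₂ p (verticalPart g p X) (verticalPart g p X')
    + block g a.c₃ a.d₃ p X.1 (verticalPart g p X')
    + block g a.c₃ a.d₃ p (verticalPart g p X) X'.1

end Lift

/-! ### Conformal flatness

`B p X Y` is a field of (nondegenerate symmetric bilinear) forms on an open set of a normed
space `F`; it may have any signature. -/

section ConformallyFlat

variable {F : Type*} [NormedAddCommGroup F] [NormedSpace ℝ F]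

/-- `B` is nondegenerate at every point of `D`. -/
def IsNondegenerateOn (B : F → F → F → ℝ) (D : Set F) : Prop :=
  ∀ p ∈ D, ∀ X : F, (∀ Y : F, B p X Y = 0) → X = 0

/-- `B` is locally (pseudo-)Euclidean on `D`: around each point of `D` there are smooth
coordinates `φ` in which `B` becomes a constant nondegenerate symmetric bilinear form `η`.
If `B` is positive definite then so is `η`, and `B` is locally isometric to Euclidean space. -/
def IsLocallyEuclideanOn (B : F → F → F → ℝ) (D : Set F) : Prop :=
  ∀ p ∈ D, ∃ (φ : OpenPartialHomeomorph F F) (η : LinearMap.BilinForm ℝ F),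
    p ∈ φ.source ∧ φ.source ⊆ D ∧
    ContDiffOn ℝ ∞ φ φ.source ∧ ContDiffOn ℝ ∞ φ.symm φ.target ∧
    η.IsSymm ∧ η.Nondegenerate ∧
    ∀ q ∈ φ.source, ∀ X Y : F, B q X Y = η (fderiv ℝ φ q X) (fderiv ℝ φ q Y)

/-- `B` is conformally flat on `D`: around each point of `D` there is a smooth positive function
`ρ` such that the conformally related metric `ρ² B` is locally (pseudo-)Euclidean. -/
def IsConformallyFlatOn (B : F → F → F → ℝ) (D : Set F) : Prop :=
  ∀ p ∈ D, ∃ (W : Set F) (ρ : F → ℝ), IsOpen W ∧ p ∈ W ∧ W ⊆ D ∧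
    ContDiffOn ℝ ∞ ρ W ∧ (∀ q ∈ W, 0 < ρ q) ∧
    IsLocallyEuclideanOn (fun q X Y => ρ q ^ 2 * B q X Y) W

end ConformallyFlat

/-! ### The global objects: a Riemannian manifold `(M, g)` and its tangent bundle `(TM, G)` -/

section Manifold

variable {n : ℕ} {M : Type*} [TopologicalSpace M] [ChartedSpace (Coord n) M]
  [IsManifold (𝓡 n) ∞ M]

/-- The matrix `g_{ij} = g(∂/∂xⁱ, ∂/∂xʲ)` of the metric in the local chart `e`, as a function of the
coordinates (meaningful on `e.target`). -/
def metricMatrix (g : SmoothMetric n M) (e : OpenPartialHomeomorph M (Coord n)) (x : Coord n) :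
    Matrix (Fin n) (Fin n) ℝ :=
  Matrix.of fun i j => g.inner (e.symm x)
    (mfderiv (𝓡 n) (𝓡 n) e.symm x (EuclideanSpace.single i (1 : ℝ) : Coord n))
    (mfderiv (𝓡 n) (𝓡 n) e.symm x (EuclideanSpace.single j (1 : ℝ) : Coord n))

/-- The range `e.target × ℝⁿ` of the local chart `(x, y)` of `TM` induced by the local chart `e`
of `M`. -/
def inducedRange (e : OpenPartialHomeomorph M (Coord n)) : Set (Coord n × Coord n) :=
  e.target ×ˢ Set.univ

/-- The general natural lifted metric `G` on `TM` with coefficients `a` is nondegenerate. (The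
induced charts cover `TM`.) -/
def LiftNondegenerate (a : Coefficients) (g : SmoothMetric n M) : Prop :=
  ∀ e ∈ IsManifold.maximalAtlas (𝓡 n) ∞ M,
    IsNondegenerateOn (liftedMetric a (metricMatrix g e)) (inducedRange e)

/-- The tangent bundle `TM` with the general natural lifted metric `G` is conformally flat. (The
induced charts cover `TM`.) -/
def LiftConformallyFlat (a : Coefficients) (g : SmoothMetric n M) : Prop :=
  ∀ e ∈ IsManifold.maximalAtlas (𝓡 n) ∞ M,
    IsConformallyFlatOn (liftedMetric a (metricMatrix g e)) (inducedRange e)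

/-- Every tangent plane of `(M, g)`, at every point, has sectional curvature `c`. -/
def HasConstantSectionalCurvature (g : SmoothMetric n M) (c : ℝ) : Prop :=
  ∀ e ∈ IsManifold.maximalAtlas (𝓡 n) ∞ M, ∀ x ∈ e.target, ∀ v w : Coord n,
    LinearIndependent ℝ ![v, w] → sectionalCurvature (metricMatrix g e) x v w = c

/-- In every local chart, `R^h_{kij} = c (g_{jk} δ^h_i - g_{ik} δ^h_j)`. -/
def HasSpaceFormCurvature (g : SmoothMetric n M) (c : ℝ) : Prop :=
  ∀ e ∈ IsManifold.maximalAtlas (𝓡 n) ∞ M, ∀ x ∈ e.target, ∀ h k i j : Fin n,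
    riemann (metricMatrix g e) x h k i j =
      c * (metricMatrix g e x j k * (1 : Matrix (Fin n) (Fin n) ℝ) h i
        - metricMatrix g e x i k * (1 : Matrix (Fin n) (Fin n) ℝ) h j)

end Manifold

end NaturalLift

end

/-! Conformal flatness is used only at the zero section, and without the Weyl tensor. A conformally
flat metric immerses isometrically, locally, in the null cone of a flat space with two extra
dimensions of signature (1,1): if `φ` flattens `ρ²G`, take `ρ⁻¹ (φ, 1, -½ η(φ, φ))`. Differentiating
the null condition and using the Gauss equation, at a point where the first derivatives of `G`
vanish the curvature is the Kulkarni–Nomizu product of `G` with a symmetric tensor `S`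
(`exists_schouten`). On four vectors with the mutual `G`-products pairing `u, v` with `w, z` zero,
the derivative of the linear part of the curvature vanishes as well (`dirDeriv_curvComb_eq_zero`).
Neither fact needs a restriction on the dimension.

In coordinates of `M` normal at `x`, the first derivatives of `G` vanish at `(x, 0)`, and the second
ones are computed from Taylor expansions along lines and polarization (`secondDeriv_liftedMetric`).
Feeding suitable tangent vectors at `(x, 0)` into the Kulkarni–Nomizu identity gives three cases.

If `c₂(0) ≠ 0`, pair the vectors `(X, -eX)` orthogonal to the fibre with vertical ones: every term
with `S` drops out, and the curvature of `g` is a constant built from the coefficients at 0 alone.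
If `c₂(0) = 0` and `c₁(0) ≠ 0`, then `c₃(0) ≠ 0` by nondegeneracy, and the totally null space of
vectors `(X, -eX)`, for another `e`, does the same. If `c₁(0) = c₂(0) = 0`, three horizontal vectors
and a vertical one show that `S` restricted to horizontal vectors is a multiple of `g`, so that the
curvature is constant at each point, with a value that may still depend on `x`. Schur's lemma would
fail for surfaces; instead, the fibre derivative of the curvature of `G` on horizontal vectors is
`c₃(0)` times the derivative of the curvature of `g`, and it vanishes because horizontal vectors are
null (`dirDeriv_curvComb_form_eq_zero`). The curvature is then locally constant, hence constant on
the connected `M`.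

Tensoriality of the curvature transfers the result from normal charts to all charts. For `n ≤ 1` the
curvature is zero. -/

open scoped Manifold ContDiff Topology
open Asymptotics Filter

noncomputable section

namespace NaturalLift

/-! ### Calculus of derivatives in constant directions -/

section DirectionalDerivative

variable {F E E' H : Type*} [NormedAddCommGroup F] [NormedSpace ℝ F]
  [NormedAddCommGroup E] [NormedSpace ℝ E] [NormedAddCommGroup E'] [NormedSpace ℝ E']
  [NormedAddCommGroup H] [NormedSpace ℝ H] {W : Set F} {q : F}

/-- The derivative of `f` in the constant direction `v`. -/
def dirDeriv (v : F) (f : F → E) (q : F) : E := fderiv ℝ f q v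

theorem dirDeriv_congr {f h : F → E} (hW : IsOpen W) (hfh : Set.EqOn f h W) (hq : q ∈ W) (v : F) :
    dirDeriv v f q = dirDeriv v h q := by
  unfold dirDeriv
  rw [(hfh.eventuallyEq_of_mem (hW.mem_nhds hq)).fderiv_eq]

theorem eqOn_dirDeriv {f h : F → E} (hW : IsOpen W) (hfh : Set.EqOn f h W) (v : F) :
    Set.EqOn (dirDeriv v f) (dirDeriv v h) W := fun _ hq => dirDeriv_congr hW hfh hq v

theorem contDiffOn_dirDeriv {f : F → E} (hW : IsOpen W) (hf : ContDiffOn ℝ ∞ f W) (v : F) :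
    ContDiffOn ℝ ∞ (dirDeriv v f) W :=
  (hf.fderiv_of_isOpen hW (by simp)).clm_apply contDiffOn_const

theorem differentiableAt_of_contDiffOn {f : F → E} (hW : IsOpen W) (hf : ContDiffOn ℝ ∞ f W)
    (hq : q ∈ W) : DifferentiableAt ℝ f q :=
  (hf.contDiffAt (hW.mem_nhds hq)).differentiableAt (by simp)

theorem dirDeriv_dirDeriv {f : F → E} (hW : IsOpen W) (hf : ContDiffOn ℝ ∞ f W) (hq : q ∈ W)
    (a b : F) : dirDeriv a (dirDeriv b f) q = fderiv ℝ (fderiv ℝ f) q a b := by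
  have hd : DifferentiableAt ℝ (fderiv ℝ f) q :=
    differentiableAt_of_contDiffOn hW (hf.fderiv_of_isOpen hW (by simp)) hq
  unfold dirDeriv
  rw [fderiv_clm_apply hd (differentiableAt_const b)]
  simp

theorem dirDeriv_comm {f : F → E} (hW : IsOpen W) (hf : ContDiffOn ℝ ∞ f W) (hq : q ∈ W)
    (a b : F) : dirDeriv a (dirDeriv b f) q = dirDeriv b (dirDeriv a f) q := by
  rw [dirDeriv_dirDeriv hW hf hq, dirDeriv_dirDeriv hW hf hq]
  exact ((hf.contDiffAt (hW.mem_nhds hq)).isSymmSndFDerivAt (by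
    rw [minSmoothness_of_isRCLikeNormedField]
    exact WithTop.coe_le_coe.2 le_top)).eq a b

theorem dirDeriv_add_left (u v : F) (f : F → E) (q : F) :
    dirDeriv (u + v) f q = dirDeriv u f q + dirDeriv v f q := by
  simp [dirDeriv]

theorem dirDeriv_const (v : F) (c : E) (q : F) : dirDeriv v (fun _ => c) q = 0 := by
  simp [dirDeriv]

theorem dirDeriv_add {f h : F → E} (hf : DifferentiableAt ℝ f q) (hh : DifferentiableAt ℝ h q)
    (v : F) : dirDeriv v (fun x => f x + h x) q = dirDeriv v f q + dirDeriv v h q := by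
  unfold dirDeriv
  rw [fderiv_fun_add hf hh]; rfl

theorem dirDeriv_sub {f h : F → E} (hf : DifferentiableAt ℝ f q) (hh : DifferentiableAt ℝ h q)
    (v : F) : dirDeriv v (fun x => f x - h x) q = dirDeriv v f q - dirDeriv v h q := by
  unfold dirDeriv
  rw [fderiv_fun_sub hf hh]; rfl

theorem dirDeriv_const_mul {f : F → ℝ} (hf : DifferentiableAt ℝ f q) (r : ℝ) (v : F) :
    dirDeriv v (fun x => r * f x) q = r * dirDeriv v f q := by
  unfold dirDeriv
  rw [fderiv_const_mul hf]; rfl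

theorem dirDeriv_mul {f h : F → ℝ} (hf : DifferentiableAt ℝ f q) (hh : DifferentiableAt ℝ h q)
    (v : F) : dirDeriv v (fun x => f x * h x) q = f q * dirDeriv v h q + h q * dirDeriv v f q := by
  unfold dirDeriv
  rw [fderiv_fun_mul hf hh]; rfl

theorem dirDeriv_smul {f : F → ℝ} {h : F → E} (hf : DifferentiableAt ℝ f q)
    (hh : DifferentiableAt ℝ h q) (v : F) :
    dirDeriv v (fun x => f x • h x) q = f q • dirDeriv v h q + dirDeriv v f q • h q := by
  unfold dirDeriv
  rw [fderiv_fun_smul hf hh]; rfl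

theorem dirDeriv_clm_apply {c : F → E →L[ℝ] H} {f : F → E} (hc : DifferentiableAt ℝ c q)
    (hf : DifferentiableAt ℝ f q) (v : F) :
    dirDeriv v (fun x => c x (f x)) q = dirDeriv v c q (f q) + c q (dirDeriv v f q) := by
  unfold dirDeriv
  rw [fderiv_clm_apply hc hf]
  simp [add_comm]

theorem dirDeriv_clm_apply₂ {c : F → E →L[ℝ] E' →L[ℝ] H} {f : F → E} {h : F → E'}
    (hc : DifferentiableAt ℝ c q) (hf : DifferentiableAt ℝ f q) (hh : DifferentiableAt ℝ h q)
    (v : F) :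
    dirDeriv v (fun x => c x (f x) (h x)) q
      = dirDeriv v c q (f q) (h q) + c q (dirDeriv v f q) (h q) + c q (f q) (dirDeriv v h q) := by
  rw [dirDeriv_clm_apply (hc.clm_apply hf) hh, dirDeriv_clm_apply hc hf]
  simp

theorem dirDeriv_bilin (b : E →L[ℝ] E' →L[ℝ] H) {f : F → E} {h : F → E'}
    (hf : DifferentiableAt ℝ f q) (hh : DifferentiableAt ℝ h q) (v : F) :
    dirDeriv v (fun x => b (f x) (h x)) q = b (dirDeriv v f q) (h q) + b (f q) (dirDeriv v h q) := by
  rw [dirDeriv_clm_apply₂ (differentiableAt_const b) hf hh, dirDeriv_const]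
  simp

theorem dirDeriv_comp {f : E → H} {ψ : F → E} (hf : DifferentiableAt ℝ f (ψ q))
    (hψ : DifferentiableAt ℝ ψ q) (v : F) :
    dirDeriv v (fun x => f (ψ x)) q = dirDeriv (dirDeriv v ψ q) f (ψ q) := by
  unfold dirDeriv
  rw [fderiv_fun_comp q hf hψ]; rfl

end DirectionalDerivative

/-! ### Second order Taylor expansions in one variable -/

section TaylorTwo

/-- `f s = a + b s + c s² + o(s²)` as `s → 0`. -/
def TaylorTwo (f : ℝ → ℝ) (a b c : ℝ) : Prop :=
  (fun s => f s - (a + b * s + c * s ^ 2)) =o[𝓝 0] (fun s : ℝ => s ^ 2)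

namespace TaylorTwo

variable {f h : ℝ → ℝ} {a b c a' b' c' : ℝ}

theorem congr (hf : TaylorTwo f a b c) (hfh : ∀ s, f s = h s) (ha : a = a') (hb : b = b')
    (hc : c = c') : TaylorTwo h a' b' c' := by
  subst ha hb hc
  rwa [← funext hfh]

theorem add (hf : TaylorTwo f a b c) (hh : TaylorTwo h a' b' c') :
    TaylorTwo (fun s => f s + h s) (a + a') (b + b') (c + c') := by
  refine (IsLittleO.add hf hh).congr_left fun s => ?_
  ring

theorem polynomial (a b c : ℝ) : TaylorTwo (fun s => a + b * s + c * s ^ 2) a b c := by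
  unfold TaylorTwo
  simp

theorem const (a : ℝ) : TaylorTwo (fun _ => a) a 0 0 :=
  (polynomial a 0 0).congr (fun s => by ring) rfl rfl rfl

theorem id : TaylorTwo (fun s => s) 0 1 0 :=
  (polynomial 0 1 0).congr (fun s => by ring) rfl rfl rfl

theorem isBigO_one (hf : TaylorTwo f a b c) : f =O[𝓝 0] (fun _ => (1 : ℝ)) := by
  have h1 : (fun s : ℝ => s ^ 2) =O[𝓝 0] (fun _ => (1 : ℝ)) :=
    ((continuous_pow 2).tendsto (0 : ℝ)).isBigO_one ℝ
  have h2 : (fun s : ℝ => a + b * s + c * s ^ 2) =O[𝓝 0] (fun _ => (1 : ℝ)) :=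
    ((by fun_prop : Continuous fun s : ℝ => a + b * s + c * s ^ 2).tendsto (0 : ℝ)).isBigO_one ℝ
  exact ((hf.isBigO.trans h1).add h2).congr_left fun s => by ring

theorem mul (hf : TaylorTwo f a b c) (hh : TaylorTwo h a' b' c') :
    TaylorTwo (fun s => f s * h s) (a * a') (a * b' + b * a') (a * c' + b * b' + c * a') := by
  have h2 : (fun s : ℝ => a + b * s + c * s ^ 2) =O[𝓝 0] (fun _ => (1 : ℝ)) :=
    (polynomial a b c).isBigO_one
  have e1 : (fun s => (f s - (a + b * s + c * s ^ 2)) * h s) =o[𝓝 0] (fun s : ℝ => s ^ 2) :=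
    (IsLittleO.mul_isBigO hf hh.isBigO_one).congr_right fun s => by ring
  have e2 : (fun s => (a + b * s + c * s ^ 2) * (h s - (a' + b' * s + c' * s ^ 2)))
      =o[𝓝 0] (fun s : ℝ => s ^ 2) :=
    (h2.mul_isLittleO hh).congr_right fun s => by ring
  have e3 : (fun s : ℝ => s ^ 2 * (s * ((b * c' + c * b') + c * c' * s)))
      =o[𝓝 0] (fun s : ℝ => s ^ 2) := by
    have : (fun s : ℝ => s * ((b * c' + c * b') + c * c' * s)) =o[𝓝 0] (fun _ => (1 : ℝ)) := by
      rw [isLittleO_one_iff]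
      have := (by fun_prop : Continuous fun s : ℝ => s * ((b * c' + c * b') + c * c' * s)).tendsto 0
      simpa using this
    exact ((isBigO_refl (fun s : ℝ => s ^ 2) (𝓝 0)).mul_isLittleO this).congr_right
      fun s => by ring
  refine ((e1.add e2).add e3).congr_left fun s => ?_
  ring

/-- Lets the coefficients of an explicit expansion be identified with derivatives known to exist.
They are found in turn, dividing by `s` and `s²` on the punctured neighbourhood. -/
theorem unique (hf : TaylorTwo f a b c) (hf' : TaylorTwo f a' b' c') :
    a = a' ∧ b = b' ∧ c = c' := by
  have key : (fun s : ℝ => (a' - a) + (b' - b) * s + (c' - c) * s ^ 2) =o[𝓝 0]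
      (fun s : ℝ => s ^ 2) := (IsLittleO.sub hf hf').congr_left fun s => by ring
  have ha : a' - a = 0 := by
    have h1 : (fun s : ℝ => s ^ 2) =O[𝓝 0] (fun _ => (1 : ℝ)) :=
      ((continuous_pow 2).tendsto (0 : ℝ)).isBigO_one ℝ
    have h2 := (isLittleO_one_iff ℝ).1 (key.trans_isBigO h1)
    have h3 := (by fun_prop : Continuous fun s : ℝ =>
      (a' - a) + (b' - b) * s + (c' - c) * s ^ 2).tendsto 0
    simpa using tendsto_nhds_unique h3 h2
  have hne : ∀ᶠ s : ℝ in 𝓝[≠] 0, s ≠ 0 := eventually_mem_nhdsWithin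
  have hb : b' - b = 0 := by
    have h1 : (fun s : ℝ => (b' - b) * s + (c' - c) * s ^ 2) =o[𝓝[≠] 0] (fun s : ℝ => s ^ 2) :=
      (key.mono nhdsWithin_le_nhds).congr_left fun s => by rw [ha]; ring
    have h2 : (fun s : ℝ => (b' - b) + (c' - c) * s) =o[𝓝[≠] 0] (fun s : ℝ => s) := by
      have := (isBigO_refl (fun s : ℝ => s⁻¹) (𝓝[≠] 0)).mul_isLittleO h1
      refine this.congr' ?_ ?_ <;> filter_upwards [hne] with s hs <;> field_simp
    have h3 : (fun s : ℝ => s) =O[𝓝[≠] 0] (fun _ => (1 : ℝ)) :=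
      ((continuous_id.tendsto (0 : ℝ)).mono_left nhdsWithin_le_nhds).isBigO_one ℝ
    have h4 := (isLittleO_one_iff ℝ).1 (h2.trans_isBigO h3)
    have h5 := ((by fun_prop : Continuous fun s : ℝ =>
      (b' - b) + (c' - c) * s).tendsto 0).mono_left (nhdsWithin_le_nhds (s := {0}ᶜ))
    simpa using tendsto_nhds_unique h5 h4
  have hc : c' - c = 0 := by
    have h1 : (fun s : ℝ => (c' - c) * s ^ 2) =o[𝓝[≠] 0] (fun s : ℝ => s ^ 2) :=
      (key.mono nhdsWithin_le_nhds).congr_left fun s => by rw [ha, hb]; ring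
    have h2 : (fun _ : ℝ => (c' - c)) =o[𝓝[≠] 0] (fun _ : ℝ => (1 : ℝ)) := by
      have := (isBigO_refl (fun s : ℝ => (s ^ 2)⁻¹) (𝓝[≠] 0)).mul_isLittleO h1
      refine this.congr' ?_ ?_ <;> filter_upwards [hne] with s hs <;> field_simp
    exact tendsto_nhds_unique tendsto_const_nhds ((isLittleO_one_iff ℝ).1 h2)
  exact ⟨by linarith, by linarith, by linarith⟩

/-- Taylor's formula with Peano remainder: the derivative of the remainder is `o(s)`, so the mean
value inequality on the ball of radius `|s|` makes the remainder `o(s²)`. -/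
theorem of_hasDerivAt {f' : ℝ → ℝ} (hf : ∀ᶠ s in 𝓝 0, HasDerivAt f (f' s) s)
    (hf' : HasDerivAt f' c 0) : TaylorTwo f (f 0) (f' 0) (c / 2) := by
  set r : ℝ → ℝ := fun s => f s - (f 0 + f' 0 * s + c / 2 * s ^ 2) with hr
  have hr' : ∀ᶠ s in 𝓝 0, HasDerivAt r (f' s - f' 0 - c * s) s := by
    filter_upwards [hf] with s hs
    have := hs.sub (((hasDerivAt_const s (f 0)).add ((hasDerivAt_id s).const_mul (f' 0))).add
      (((hasDerivAt_id s).pow 2).const_mul (c / 2)))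
    refine this.congr_deriv ?_
    simp; ring
  have hlo : (fun s => f' s - f' 0 - c * s) =o[𝓝 0] (fun s : ℝ => s) := by
    have := hf'.isLittleO
    simp only [sub_zero, smul_eq_mul] at this
    exact this.congr_left fun s => by ring
  change r =o[𝓝 0] _
  rw [isLittleO_iff]
  intro ε hε
  have h1 := (isLittleO_iff.1 hlo hε).and hr'
  obtain ⟨δ, hδ, hball⟩ := Metric.eventually_nhds_iff_ball.1 h1
  filter_upwards [Metric.ball_mem_nhds (0 : ℝ) hδ] with s hs
  have hsub : ∀ x ∈ Metric.closedBall (0 : ℝ) |s|, x ∈ Metric.ball (0 : ℝ) δ := by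
    intro x hx
    rw [mem_closedBall_zero_iff, Real.norm_eq_abs] at hx
    rw [mem_ball_zero_iff, Real.norm_eq_abs] at hs ⊢
    linarith
  have := (convex_closedBall (0 : ℝ) |s|).norm_image_sub_le_of_norm_hasDerivWithin_le
    (f := r) (f' := fun s => f' s - f' 0 - c * s) (C := ε * |s|) (x := 0) (y := s)
    (fun x hx => ((hball x (hsub x hx)).2).hasDerivWithinAt)
    (fun x hx => ((hball x (hsub x hx)).1).trans (by
      rw [mem_closedBall_zero_iff] at hx
      exact mul_le_mul_of_nonneg_left hx hε.le))
    (by simp) (by simp)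
  have h0 : r 0 = 0 := by simp [hr]
  rw [h0, sub_zero, sub_zero, Real.norm_eq_abs s] at this
  rw [norm_pow, Real.norm_eq_abs s]
  linarith [this]

theorem of_tendsto (hf : Tendsto f (𝓝 0) (𝓝 a)) : TaylorTwo (fun s => s ^ 2 * f s) 0 0 a := by
  have h1 : (fun s => f s - a) =o[𝓝 0] (fun _ => (1 : ℝ)) := by
    rw [isLittleO_one_iff]
    simpa using hf.sub_const a
  refine ((isBigO_refl (fun s : ℝ => s ^ 2) (𝓝 0)).mul_isLittleO h1).congr (fun s => ?_)
    fun s => ?_ <;> ring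

theorem of_hasDerivAt_mul (hf : HasDerivAt f b 0) : TaylorTwo (fun s => s * f s) 0 (f 0) b := by
  have := hf.isLittleO
  simp only [sub_zero, smul_eq_mul] at this
  refine ((isBigO_refl (fun s : ℝ => s) (𝓝 0)).mul_isLittleO this).congr (fun s => ?_)
    fun s => ?_ <;> ring

theorem of_contDiffOn {F : Type*} [NormedAddCommGroup F] [NormedSpace ℝ F] {W : Set F}
    (hW : IsOpen W) {f : F → ℝ} (hf : ContDiffOn ℝ ∞ f W) {p : F} (hp : p ∈ W) (u : F) :
    TaylorTwo (fun s => f (p + s • u)) (f p) (dirDeriv u f p)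
      (dirDeriv u (dirDeriv u f) p / 2) := by
  have hline : ∀ s : ℝ, HasDerivAt (fun s : ℝ => p + s • u) u s := fun s => by
    simpa using ((hasDerivAt_id s).smul_const u).const_add p
  have hd : ∀ {h : F → ℝ}, ContDiffOn ℝ ∞ h W → ∀ s : ℝ, p + s • u ∈ W →
      HasDerivAt (fun s : ℝ => h (p + s • u)) (dirDeriv u h (p + s • u)) s := fun hh s hs =>
    (differentiableAt_of_contDiffOn hW hh hs).hasFDerivAt.comp_hasDerivAt s (hline s)
  have hmem : ∀ᶠ s : ℝ in 𝓝 0, p + s • u ∈ W := by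
    have hc : Continuous fun s : ℝ => p + s • u := by fun_prop
    exact hc.continuousAt.eventually_mem (hW.mem_nhds (by simpa using hp))
  have h0 := of_hasDerivAt (hmem.mono fun s hs => hd hf s hs)
    (hd (contDiffOn_dirDeriv hW hf u) 0 (by simpa using hp))
  simpa using h0

/-- Made for the coefficients of the lift, which are controlled only on `[0, ∞)`. The energy along a
line through the zero section has the form `s² τ(s)` with `τ ≥ 0`, so a one-sided derivative at 0 is
enough and only the limit of `τ` enters. -/
theorem comp_sq {φ : ℝ → ℝ} {φ' : ℝ} (hφ : HasDerivWithinAt φ φ' (Set.Ici 0) 0) {τ : ℝ → ℝ}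
    {τ₀ : ℝ} (hτ : Tendsto τ (𝓝 0) (𝓝 τ₀)) (hτ' : ∀ᶠ s in 𝓝 0, 0 ≤ τ s) :
    TaylorTwo (fun s => φ (s ^ 2 * τ s)) (φ 0) 0 (φ' * τ₀) := by
  have ht : Tendsto (fun s : ℝ => s ^ 2 * τ s) (𝓝 0) (𝓝[Set.Ici 0] 0) := by
    refine tendsto_nhdsWithin_iff.2 ⟨?_, hτ'.mono fun s hs => ?_⟩
    · simpa using ((continuous_pow 2).tendsto (0 : ℝ)).mul hτ
    · exact mul_nonneg (sq_nonneg s) hs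
  have h1 := hφ.isLittleO.comp_tendsto ht
  have h2 : (fun s : ℝ => s ^ 2 * τ s) =O[𝓝 0] fun s : ℝ => s ^ 2 :=
    ((isBigO_refl (fun s : ℝ => s ^ 2) (𝓝 0)).mul (hτ.isBigO_one ℝ)).congr_right
      fun s => by ring
  have h3 : (fun s => φ (s ^ 2 * τ s) - φ 0 - s ^ 2 * τ s * φ') =o[𝓝 0] fun s : ℝ => s ^ 2 := by
    refine IsLittleO.trans_isBigO ?_ h2
    simpa [Function.comp_def] using h1
  have h4 : (fun s : ℝ => s ^ 2 * (φ' * τ s) - (0 + 0 * s + (φ' * τ₀) * s ^ 2)) =o[𝓝 0]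
      fun s : ℝ => s ^ 2 := of_tendsto (hτ.const_mul φ')
  refine (h3.add h4).congr_left fun s => ?_
  ring

end TaylorTwo

end TaylorTwo

/-! ### Conformally flat metrics as immersions in a null cone -/

section ConformalCurvature

variable {F E : Type*} [NormedAddCommGroup F] [NormedSpace ℝ F]
  [NormedAddCommGroup E] [NormedSpace ℝ E]

/-- The second derivative of `q ↦ B q c d` in the constant directions `a`, `b`. -/
def secondDeriv (B : F → F → F → ℝ) (q a b c d : F) : ℝ :=
  dirDeriv a (dirDeriv b (fun x => B x c d)) q

/-- The linear part of (twice) the lowered curvature tensor of `B` in a coordinate system. -/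
def curvComb (B : F → F → F → ℝ) (q u v w z : F) : ℝ :=
  secondDeriv B q u w v z + secondDeriv B q v z u w - secondDeriv B q u z v w
    - secondDeriv B q v w u z

/-- An isometric immersion `Φ` of `B` into the null cone of a flat space `(E, b)`, together with
a null vector `N` that spans the normal space at `p` together with `Φ p`. -/
structure ConeImmersion (B : F → F → F → ℝ) (W : Set F) (p : F) (E : Type*)
    [NormedAddCommGroup E] [NormedSpace ℝ E] where
  /-- the flat metric -/
  b : E →L[ℝ] E →L[ℝ] ℝ
  /-- the immersion -/
  Φ : F → E
  /-- the transversal null normal -/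
  N : E
  symm : ∀ x y, b x y = b y x
  smooth : ContDiffOn ℝ ∞ Φ W
  null : ∀ q ∈ W, b (Φ q) (Φ q) = 0
  metric : ∀ q ∈ W, ∀ X Y, B q X Y = b (dirDeriv X Φ q) (dirDeriv Y Φ q)
  normal : ∀ V, (∀ X, b V (dirDeriv X Φ p) = 0) → V = b V N • Φ p + b V (Φ p) • N

namespace ConeImmersion

variable {B : F → F → F → ℝ} {W : Set F} {p q : F} (ι : ConeImmersion B W p E)

include ι in
-- Smoothness of `B` is inherited from the immersion. For the lifted metric this avoids proving
-- directly that functions of the energy, smooth only on `[0, ∞)`, stay smooth across the zero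
-- section.
theorem contDiffOn_metric (hW : IsOpen W) (w z : F) : ContDiffOn ℝ ∞ (fun q => B q w z) W :=
  ((ι.b.contDiff.comp_contDiffOn (contDiffOn_dirDeriv hW ι.smooth w)).clm_apply
    (contDiffOn_dirDeriv hW ι.smooth z)).congr fun q hq => ι.metric q hq w z

theorem diff₁ (hW : IsOpen W) (hq : q ∈ W) (a : F) :
    DifferentiableAt ℝ (dirDeriv a ι.Φ) q :=
  differentiableAt_of_contDiffOn hW (contDiffOn_dirDeriv hW ι.smooth a) hq

theorem diff₂ (hW : IsOpen W) (hq : q ∈ W) (a b : F) :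
    DifferentiableAt ℝ (dirDeriv a (dirDeriv b ι.Φ)) q :=
  differentiableAt_of_contDiffOn hW
    (contDiffOn_dirDeriv hW (contDiffOn_dirDeriv hW ι.smooth b) a) hq

theorem dirDeriv_metric (hW : IsOpen W) (hq : q ∈ W) (a c d : F) :
    dirDeriv a (fun x => B x c d) q = ι.b (dirDeriv a (dirDeriv c ι.Φ) q) (dirDeriv d ι.Φ q)
      + ι.b (dirDeriv c ι.Φ q) (dirDeriv a (dirDeriv d ι.Φ) q) := by
  rw [dirDeriv_congr hW (fun x hx => ι.metric x hx c d) hq,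
    dirDeriv_bilin _ (ι.diff₁ hW hq c) (ι.diff₁ hW hq d)]

theorem secondDeriv_metric (hW : IsOpen W) (hq : q ∈ W) (a e c d : F) :
    secondDeriv B q a e c d
      = ι.b (dirDeriv a (dirDeriv e (dirDeriv c ι.Φ)) q) (dirDeriv d ι.Φ q)
      + ι.b (dirDeriv e (dirDeriv c ι.Φ) q) (dirDeriv a (dirDeriv d ι.Φ) q)
      + (ι.b (dirDeriv a (dirDeriv c ι.Φ) q) (dirDeriv e (dirDeriv d ι.Φ) q)
      + ι.b (dirDeriv c ι.Φ q) (dirDeriv a (dirDeriv e (dirDeriv d ι.Φ)) q)) := by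
  unfold secondDeriv
  have h1 := ι.contDiffOn_metric hW c d
  have hs : ∀ x y : F, ContDiffOn ℝ ∞
      (fun q => ι.b (dirDeriv x (dirDeriv y ι.Φ) q) (dirDeriv d ι.Φ q)) W := fun x y =>
    (ι.b.contDiff.comp_contDiffOn (contDiffOn_dirDeriv hW (contDiffOn_dirDeriv hW ι.smooth y)
      x)).clm_apply (contDiffOn_dirDeriv hW ι.smooth d)
  have hs' : ∀ x y : F, ContDiffOn ℝ ∞
      (fun q => ι.b (dirDeriv c ι.Φ q) (dirDeriv x (dirDeriv y ι.Φ) q)) W := fun x y =>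
    (ι.b.contDiff.comp_contDiffOn (contDiffOn_dirDeriv hW ι.smooth c)).clm_apply
      (contDiffOn_dirDeriv hW (contDiffOn_dirDeriv hW ι.smooth y) x)
  rw [dirDeriv_congr hW (fun x hx => ι.dirDeriv_metric hW hx e c d) hq,
    dirDeriv_add (differentiableAt_of_contDiffOn hW (hs _ _) hq)
      (differentiableAt_of_contDiffOn hW (hs' _ _) hq),
    dirDeriv_bilin _ (ι.diff₂ hW hq e c) (ι.diff₁ hW hq d),
    dirDeriv_bilin _ (ι.diff₁ hW hq c) (ι.diff₂ hW hq e d)]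

theorem second_comm (hW : IsOpen W) (hq : q ∈ W) (a c : F) :
    dirDeriv a (dirDeriv c ι.Φ) q = dirDeriv c (dirDeriv a ι.Φ) q :=
  dirDeriv_comm hW ι.smooth hq a c

theorem third_comm_left (hW : IsOpen W) (hq : q ∈ W) (a e c : F) :
    dirDeriv a (dirDeriv e (dirDeriv c ι.Φ)) q = dirDeriv e (dirDeriv a (dirDeriv c ι.Φ)) q :=
  dirDeriv_comm hW (contDiffOn_dirDeriv hW ι.smooth c) hq a e

theorem third_comm_right (hW : IsOpen W) (hq : q ∈ W) (a e c : F) :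
    dirDeriv a (dirDeriv e (dirDeriv c ι.Φ)) q = dirDeriv a (dirDeriv c (dirDeriv e ι.Φ)) q :=
  dirDeriv_congr hW (fun _ hx => ι.second_comm hW hx e c) hq a

/-- The Gauss equation. -/
theorem curvComb_eq (hW : IsOpen W) (hq : q ∈ W) (u v w z : F) :
    curvComb B q u v w z
      = 2 * (ι.b (dirDeriv v (dirDeriv w ι.Φ) q) (dirDeriv u (dirDeriv z ι.Φ) q)
        - ι.b (dirDeriv u (dirDeriv w ι.Φ) q) (dirDeriv v (dirDeriv z ι.Φ) q)) := by
  unfold curvComb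
  simp only [ι.secondDeriv_metric hW hq]
  -- All derivatives are brought to a common order; the terms with third derivatives of the
  -- immersion then cancel and only products of second derivatives remain.
  rw [ι.third_comm_right hW hq u w v, ι.third_comm_right hW hq v z u,
    ι.third_comm_left hW hq v u z, ι.third_comm_right hW hq v z w,
    ι.third_comm_right hW hq u z v, ι.third_comm_right hW hq u z w,
    ι.third_comm_right hW hq v w u, ι.third_comm_left hW hq v u w,
    ι.second_comm hW hq v u, ι.second_comm hW hq w v, ι.second_comm hW hq z u,
    ι.second_comm hW hq z v, ι.second_comm hW hq w u, ι.second_comm hW hq z w]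
  simp only [ι.symm _ (dirDeriv w ι.Φ q), ι.symm _ (dirDeriv z ι.Φ q)]
  rw [ι.symm (dirDeriv u (dirDeriv z ι.Φ) q) (dirDeriv v (dirDeriv w ι.Φ) q),
    ι.symm (dirDeriv u (dirDeriv w ι.Φ) q) (dirDeriv v (dirDeriv z ι.Φ) q)]
  ring

theorem first_position (hW : IsOpen W) (hq : q ∈ W) (a : F) :
    ι.b (dirDeriv a ι.Φ q) (ι.Φ q) = 0 := by
  have hd := differentiableAt_of_contDiffOn hW ι.smooth hq
  have h := dirDeriv_congr hW ι.null hq a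
  rw [dirDeriv_bilin _ hd hd, ι.symm (ι.Φ q)] at h
  change _ = dirDeriv a (fun _ => (0 : ℝ)) q at h
  rw [dirDeriv_const] at h
  linarith

/-- The null condition differentiated twice: the component of the second fundamental form along the
position vector is the metric itself. -/
theorem second_position (hW : IsOpen W) (hq : q ∈ W) (a c : F) :
    ι.b (dirDeriv a (dirDeriv c ι.Φ) q) (ι.Φ q) = -B q a c := by
  have hd := differentiableAt_of_contDiffOn hW ι.smooth hq
  have h := dirDeriv_congr hW (fun x hx => ι.first_position hW hx c) hq a
  rw [dirDeriv_bilin _ (ι.diff₁ hW hq c) hd, dirDeriv_const, ι.symm (dirDeriv c ι.Φ q)] at h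
  rw [ι.metric q hq]
  linarith

theorem third_position (hW : IsOpen W) (hq : q ∈ W) (s a c : F) :
    ι.b (dirDeriv s (dirDeriv a (dirDeriv c ι.Φ)) q) (ι.Φ q)
      = -dirDeriv s (fun x => B x a c) q
        - ι.b (dirDeriv a (dirDeriv c ι.Φ) q) (dirDeriv s ι.Φ q) := by
  have hd := differentiableAt_of_contDiffOn hW ι.smooth hq
  have h := dirDeriv_congr hW (fun x hx => ι.second_position hW hx a c) hq s
  have h2 : dirDeriv s (fun x => -B x a c) q = -dirDeriv s (fun x => B x a c) q := by
    unfold dirDeriv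
    rw [fderiv_fun_neg]; rfl
  rw [dirDeriv_bilin _ (ι.diff₂ hW hq a c) hd, h2] at h
  linarith

variable (hW : IsOpen W) (hp : p ∈ W) (hB : ∀ u w z, dirDeriv u (fun x => B x w z) p = 0)

include hW hp hB in
-- The Koszul argument: the expression is symmetric in `a, c` and, as the first derivatives of `B`
-- vanish at `p`, antisymmetric in `c, d`. Second derivatives of the immersion are therefore normal
-- at `p`.
theorem second_tangent (a c d : F) :
    ι.b (dirDeriv a (dirDeriv c ι.Φ) p) (dirDeriv d ι.Φ p) = 0 := by
  have key : ∀ a c d : F, ι.b (dirDeriv a (dirDeriv c ι.Φ) p) (dirDeriv d ι.Φ p)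
      + ι.b (dirDeriv a (dirDeriv d ι.Φ) p) (dirDeriv c ι.Φ p) = 0 := by
    intro a c d
    rw [← hB a c d, ι.dirDeriv_metric hW hp, ι.symm (dirDeriv c ι.Φ p)]
  have h1 := key a c d
  have h2 := key c d a
  have h3 := key d a c
  rw [ι.second_comm hW hp c d] at h2
  rw [ι.second_comm hW hp d a] at h3
  rw [ι.second_comm hW hp c a] at h2
  linarith

include hW hp hB in
-- Expand one second derivative in the normal frame `Φ p`, `N`. Its coefficient along `N` is minus
-- the metric, and its coefficient along `Φ p` is what becomes the Schouten-type tensor.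
theorem second_inner (a c d e : F) :
    ι.b (dirDeriv a (dirDeriv c ι.Φ) p) (dirDeriv d (dirDeriv e ι.Φ) p)
      = -(ι.b (dirDeriv a (dirDeriv c ι.Φ) p) ι.N * B p d e
        + B p a c * ι.b (dirDeriv d (dirDeriv e ι.Φ) p) ι.N) := by
  conv_lhs => rw [ι.normal _ (ι.second_tangent hW hp hB a c)]
  rw [ι.second_position hW hp]
  simp only [map_add, map_smul, add_apply, smul_apply,
    smul_eq_mul]
  rw [ι.symm (ι.Φ p), ι.symm ι.N, ι.second_position hW hp]
  ring

include ι hW hp hB in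
/-- At a point where the first derivatives of a conformally flat metric vanish, its curvature is
the Kulkarni–Nomizu product of the metric with a symmetric tensor. -/
theorem exists_schouten : ∃ S : F → F → ℝ, (∀ a c, S a c = S c a) ∧ ∀ u v w z,
    curvComb B p u v w z = 2 * (S u w * B p v z + B p u w * S v z
      - S v w * B p u z - B p v w * S u z) := by
  refine ⟨fun a c => ι.b (dirDeriv a (dirDeriv c ι.Φ) p) ι.N, fun a c => ?_, fun u v w z => ?_⟩
  · change ι.b _ _ = ι.b _ _
    rw [ι.second_comm hW hp a c]
  · rw [ι.curvComb_eq hW hp, ι.second_inner hW hp hB, ι.second_inner hW hp hB]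
    ring

include hW hp hB in
-- When `B p d e = 0` the second derivative in the directions `d, e` is a multiple of `Φ p`. The
-- component of a third derivative along `Φ p` consists of a first derivative of `B` and a
-- tangential part of a second derivative, both zero at `p`.
theorem third_second_inner {d e : F} (hde : B p d e = 0) (s a c : F) :
    ι.b (dirDeriv s (dirDeriv a (dirDeriv c ι.Φ)) p) (dirDeriv d (dirDeriv e ι.Φ) p) = 0 := by
  rw [ι.normal _ (ι.second_tangent hW hp hB d e), ι.second_position hW hp, hde, neg_zero,
    zero_smul, add_zero, map_smul, ι.third_position hW hp, hB, ι.second_tangent hW hp hB]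
  simp

include ι hW hp hB in
-- Differentiate the Gauss equation: each term pairs a third derivative of the immersion with a
-- second derivative in directions whose `B`-product vanishes. This takes the place of Schur's lemma
-- in the last case and works in every dimension.
theorem dirDeriv_curvComb_eq_zero {u v w z : F} (huw : B p u w = 0) (hvz : B p v z = 0)
    (huz : B p u z = 0) (hvw : B p v w = 0) (s : F) :
    dirDeriv s (fun q => curvComb B q u v w z) p = 0 := by
  have hd := fun x y => ι.diff₂ hW hp x y
  have hdb : ∀ x y x' y' : F, DifferentiableAt ℝ (fun q =>
      ι.b (dirDeriv x (dirDeriv y ι.Φ) q) (dirDeriv x' (dirDeriv y' ι.Φ) q)) p := fun x y x' y' =>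
    ((ι.b.differentiableAt).comp p (hd x y)).clm_apply (hd x' y')
  rw [dirDeriv_congr hW (fun q hq => ι.curvComb_eq hW hq u v w z) hp,
    dirDeriv_const_mul ((hdb _ _ _ _).fun_sub (hdb _ _ _ _)),
    dirDeriv_sub (hdb _ _ _ _) (hdb _ _ _ _), dirDeriv_bilin _ (hd _ _) (hd _ _),
    dirDeriv_bilin _ (hd _ _) (hd _ _), ι.third_second_inner hW hp hB huz,
    ι.third_second_inner hW hp hB hvz, ι.symm (dirDeriv v (dirDeriv w ι.Φ) p),
    ι.symm (dirDeriv u (dirDeriv w ι.Φ) p), ι.third_second_inner hW hp hB hvw,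
    ι.third_second_inner hW hp hB huw]
  simp

end ConeImmersion

/-- The flat metric of signature `η + (1, 1)`. -/
def ambientForm [FiniteDimensional ℝ F] (η : LinearMap.BilinForm ℝ F) :
    (F × ℝ × ℝ) →L[ℝ] (F × ℝ × ℝ) →L[ℝ] ℝ :=
  LinearMap.toContinuousBilinearMap (LinearMap.mk₂ ℝ
    (fun V V' : F × ℝ × ℝ => η V.1 V'.1 + V.2.1 * V'.2.2 + V.2.2 * V'.2.1)
    (fun V₁ V₂ V' => by simp; ring) (fun r V V' => by simp; ring)
    (fun V V₁ V₂ => by simp; ring) (fun r V V' => by simp; ring))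

theorem ambientForm_apply [FiniteDimensional ℝ F] (η : LinearMap.BilinForm ℝ F)
    (V V' : F × ℝ × ℝ) :
    ambientForm η V V' = η V.1 V'.1 + V.2.1 * V'.2.2 + V.2.2 * V'.2.1 := rfl

/-- The paraboloid `z ↦ (z, 1, -½ η(z, z))` lies in the null cone of the ambient form and carries
the induced metric `η`. Rescaling a null position vector by `σ` multiplies the induced metric by
`σ²`, since the position is null and orthogonal to its derivatives; `σ = 1/ρ` undoes the conformal
factor. -/
theorem exists_coneImmersion [FiniteDimensional ℝ F] {B : F → F → F → ℝ} {D : Set F}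
    (hB : IsConformallyFlatOn B D) {p : F} (hp : p ∈ D) :
    ∃ W : Set F, IsOpen W ∧ p ∈ W ∧ W ⊆ D ∧ Nonempty (ConeImmersion B W p (F × ℝ × ℝ)) := by
  obtain ⟨W, ρ, hW, hpW, hWD, hρ, hρpos, hflat⟩ := hB p hp
  obtain ⟨φ, η, hpφ, hφW, hφ, hφs, hsymm, hnd, hmet⟩ := hflat p hpW
  have hS := φ.open_source
  refine ⟨φ.source, hS, hpφ, hφW.trans hWD, ?_⟩
  have hηs : ∀ x y, η x y = η y x := fun x y => hsymm.eq x y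
  set σ : F → ℝ := fun q => (ρ q)⁻¹ with hσdef
  have hσ : ContDiffOn ℝ ∞ σ φ.source :=
    (hρ.mono hφW).inv fun q hq => (hρpos q (hφW hq)).ne'
  have hσpos : ∀ q ∈ φ.source, 0 < σ q := fun q hq => inv_pos.2 (hρpos q (hφW hq))
  set ηL : F →L[ℝ] F →L[ℝ] ℝ := LinearMap.toContinuousBilinearMap η with hηL
  have hηL' : ∀ x y, ηL x y = η x y := fun x y => rfl
  -- Centering the flat coordinates at `p` makes `Φ p = (0, σ p, 0)`, which keeps the normal frame
  -- simple.
  set ψ : F → F := fun q => φ q - φ p with hψdef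
  have hψ : ContDiffOn ℝ ∞ ψ φ.source := hφ.sub contDiffOn_const
  set κ : F → ℝ := fun q => (-1 / 2) * ηL (ψ q) (ψ q) with hκdef
  have hκ : ContDiffOn ℝ ∞ κ φ.source :=
    contDiffOn_const.mul ((ηL.contDiff.comp_contDiffOn hψ).clm_apply hψ)
  set Φ : F → F × ℝ × ℝ := fun q => (σ q • ψ q, σ q, σ q * κ q) with hΦdef
  have hΦ : ContDiffOn ℝ ∞ Φ φ.source := (hσ.smul hψ).prodMk (hσ.prodMk (hσ.mul hκ))
  have dψ : ∀ q ∈ φ.source, ∀ X, dirDeriv X ψ q = fderiv ℝ φ q X := fun q hq X => by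
    unfold dirDeriv
    rw [hψdef, fderiv_sub_const]
  have dκ : ∀ q ∈ φ.source, ∀ X, dirDeriv X κ q = -η (ψ q) (fderiv ℝ φ q X) := by
    intro q hq X
    have hd := differentiableAt_of_contDiffOn hS hψ hq
    rw [hκdef, dirDeriv_const_mul (DifferentiableAt.clm_apply (c := fun x => ηL (ψ x))
      (ηL.differentiableAt.comp q hd) hd),
      dirDeriv_bilin _ hd hd, dψ q hq, hηL', hηL', hηs _ (ψ q)]
    ring
  have dΦ : ∀ q ∈ φ.source, ∀ X, dirDeriv X Φ q
      = (σ q • fderiv ℝ φ q X + dirDeriv X σ q • ψ q, dirDeriv X σ q,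
        -(σ q * η (ψ q) (fderiv ℝ φ q X)) + κ q * dirDeriv X σ q) := by
    intro q hq X
    have h1 := differentiableAt_of_contDiffOn hS hσ hq
    have h2 := differentiableAt_of_contDiffOn hS hψ hq
    have h3 := differentiableAt_of_contDiffOn hS hκ hq
    have h4 : dirDeriv X Φ q = (dirDeriv X (fun q => σ q • ψ q) q, dirDeriv X σ q,
        dirDeriv X (fun q => σ q * κ q) q) := by
      unfold dirDeriv
      rw [hΦdef, DifferentiableAt.fderiv_prodMk (h1.fun_smul h2) (h1.prodMk (h1.fun_mul h3)),
        DifferentiableAt.fderiv_prodMk h1 (h1.fun_mul h3)]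
      rfl
    rw [h4, dirDeriv_smul h1 h2, dirDeriv_mul h1 h3, dψ q hq, dκ q hq]
    simp
  have hψp : ψ p = 0 := by simp [hψdef]
  have hκp : κ p = 0 := by simp [hκdef, hψp]
  -- the derivative of `φ` at `p` is invertible
  have hinv : ∀ x, fderiv ℝ φ p (fderiv ℝ φ.symm (φ p) x) = x := by
    have h1 : HasFDerivAt φ (fderiv ℝ φ p) (φ.symm (φ p)) := by
      rw [φ.left_inv hpφ]
      exact (differentiableAt_of_contDiffOn hS hφ hpφ).hasFDerivAt
    have h2 := (differentiableAt_of_contDiffOn φ.open_target hφs (φ.map_source hpφ)).hasFDerivAt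
    have h3 := h1.comp (φ p) h2
    have h4 : HasFDerivAt (φ ∘ φ.symm) (ContinuousLinearMap.id ℝ F) (φ p) :=
      (hasFDerivAt_id (φ p)).congr_of_eventuallyEq
        (φ.eventually_right_inverse (φ.map_source hpφ))
    intro x
    exact congrArg (fun L : F →L[ℝ] F => L x) (h3.unique h4)
  -- `n` is the `η`-gradient of `σ` at `p` in the coordinates `φ`; it enters the transversal normal
  -- `N`.
  obtain ⟨n, hn⟩ : ∃ n : F, ∀ X, η n X = fderiv ℝ σ p (fderiv ℝ φ.symm (φ p) X) :=
    ⟨(LinearMap.BilinForm.toDual η hnd).symm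
      ((fderiv ℝ σ p).comp (fderiv ℝ φ.symm (φ p)) : F →L[ℝ] ℝ).toLinearMap, fun X => by
        rw [LinearMap.BilinForm.apply_toDual_symm_apply]; rfl⟩
  refine ⟨
    { b := ambientForm η
      Φ := Φ
      -- The three components are forced by: product 1 with `Φ p`, orthogonality to the tangent
      -- space, and nullity.
      N := (-(σ p ^ 2)⁻¹ • n, -(η n n) / (2 * σ p ^ 3), (σ p)⁻¹)
      symm := fun x y => by
        rw [ambientForm_apply, ambientForm_apply, hηs]; ring
      smooth := hΦ
      null := fun q hq => by
        rw [ambientForm_apply, hΦdef]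
        simp only [map_smul, LinearMap.smul_apply, smul_eq_mul, hκdef, hηL']
        ring
      metric := fun q hq X Y => ?_
      normal := ?_ }⟩
  · have h1 := hmet q hq X Y
    have h2 : σ q * ρ q = 1 := inv_mul_cancel₀ (hρpos q (hφW hq)).ne'
    have h3 : B q X Y = σ q ^ 2 * η (fderiv ℝ φ q X) (fderiv ℝ φ q Y) := by
      rw [← h1, ← mul_assoc, ← mul_pow, h2]; simp
    rw [dΦ q hq, dΦ q hq, ambientForm_apply, h3]
    simp only [map_smul, map_add, LinearMap.add_apply, LinearMap.smul_apply, smul_eq_mul, hκdef,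
      hηL']
    rw [hηs _ (ψ q)]
    ring
  · rintro ⟨a, α, β⟩ hV
    have hσp := (hσpos p hpφ).ne'
    -- Orthogonality to the tangent space, tested on preimages of all vectors under the derivative
    -- of `φ`, determines the first component because `η` is nondegenerate. The components `α` and
    -- `β` remain free and match `Φ p` and `N`.
    have ha : a = -(β / σ p) • n := by
      have h1 : ∀ x, η (a + (β / σ p) • n) x = 0 := by
        intro x
        have h2 := hV (fderiv ℝ φ.symm (φ p) x)
        rw [dΦ p hpφ, ambientForm_apply, hinv, hψp, hκp] at h2
        simp only [smul_zero, add_zero, map_smul, smul_eq_mul, map_zero, LinearMap.zero_apply,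
          mul_zero, neg_zero, zero_mul] at h2
        rw [map_add, map_smul, LinearMap.add_apply, LinearMap.smul_apply, hn, smul_eq_mul]
        unfold dirDeriv at h2
        field_simp
        linarith
      have h3 := hnd.1 _ h1
      rw [neg_smul]
      exact eq_neg_of_add_eq_zero_left h3
    subst ha
    rw [ambientForm_apply, ambientForm_apply]
    simp only [hΦdef, hψp, hκp, map_smul, LinearMap.smul_apply, smul_eq_mul, smul_zero,
      mul_zero, map_zero, zero_add, Prod.smul_mk, Prod.mk_add_mk]
    refine Prod.ext ?_ (Prod.ext ?_ ?_)
    · simp only [smul_smul]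
      congr 1
      field_simp
    · simp only
      field_simp
      ring
    · simp only
      field_simp

end ConformalCurvature

/-! ### Two auxiliary facts on vector-valued functions -/

section VectorValued

variable {F G X : Type*} [NormedAddCommGroup F] [NormedSpace ℝ F]
  [NormedAddCommGroup G] [NormedSpace ℝ G] [NormedAddCommGroup X] [NormedSpace ℝ X]

theorem contDiffOn_smul_vector {W : Set F} {f : F → ℝ} (hf : ContDiffOn ℝ ∞ f W) (c : X) :
    ContDiffOn ℝ ∞ (fun x => f x • c) W :=
  hf.smul contDiffOn_const

theorem differentiableAt_comp_fun {c : G → X} {ψ : F → G} {q : F}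
    (hc : DifferentiableAt ℝ c (ψ q)) (hψ : DifferentiableAt ℝ ψ q) :
    DifferentiableAt ℝ (fun x => c (ψ x)) q :=
  hc.comp q hψ

end VectorValued

/-! ### Levi-Civita connection and curvature in one chart -/

section LocalGeometry

variable {n : ℕ}

/-- `g` is the matrix of a smooth Riemannian metric on the open set `U`. -/
structure IsMetricOn (g : Coord n → Matrix (Fin n) (Fin n) ℝ) (U : Set (Coord n)) : Prop where
  isOpen : IsOpen U
  smooth : ∀ i j, ContDiffOn ℝ ∞ (fun x => g x i j) U
  symm : ∀ x ∈ U, ∀ i j, g x i j = g x j i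
  pos : ∀ x ∈ U, ∀ v : Coord n, v ≠ 0 → 0 < form g x v v

/-- The metric as a continuous bilinear form. -/
def formL (g : Coord n → Matrix (Fin n) (Fin n) ℝ) (x : Coord n) :
    Coord n →L[ℝ] Coord n →L[ℝ] ℝ :=
  ∑ i, ∑ j, g x i j • (EuclideanSpace.proj i : Coord n →L[ℝ] ℝ).smulRight
    (EuclideanSpace.proj j : Coord n →L[ℝ] ℝ)

/-- The Christoffel symbols as a continuous bilinear map. -/
def christoffelL (g : Coord n → Matrix (Fin n) (Fin n) ℝ) (x : Coord n) :
    Coord n →L[ℝ] Coord n →L[ℝ] Coord n :=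
  ∑ h, ∑ i, ∑ j, christoffel g x h i j • (EuclideanSpace.proj i : Coord n →L[ℝ] ℝ).smulRight
    ((EuclideanSpace.proj j : Coord n →L[ℝ] ℝ).smulRight
      (EuclideanSpace.single h (1 : ℝ) : Coord n))

variable {g : Coord n → Matrix (Fin n) (Fin n) ℝ} {U : Set (Coord n)} {x : Coord n}

theorem formL_apply (x v w : Coord n) : formL g x v w = form g x v w := by
  simp [formL, form, mul_assoc]

theorem christoffelL_apply (x u v : Coord n) (h : Fin n) :
    christoffelL g x u v h = ∑ i, ∑ j, christoffel g x h i j * u i * v j := by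
  simp only [christoffelL, sum_apply, smul_apply,
    ContinuousLinearMap.smulRight_apply, PiLp.proj_apply, WithLp.ofLp_sum,
    Finset.sum_apply, PiLp.smul_apply, smul_eq_mul, PiLp.single_apply]
  rw [Finset.sum_eq_single h]
  · simp [mul_assoc]
  · intro b _ hb
    simp [Ne.symm hb]
  · simp

theorem form_add_left (x u v w : Coord n) : form g x (u + v) w = form g x u w + form g x v w := by
  simp [← formL_apply]

theorem form_add_right (x u v w : Coord n) : form g x u (v + w) = form g x u v + form g x u w := by
  simp [← formL_apply]

theorem form_smul_left (r : ℝ) (x v w : Coord n) : form g x (r • v) w = r * form g x v w := by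
  simp [← formL_apply]

theorem form_smul_right (r : ℝ) (x v w : Coord n) : form g x v (r • w) = r * form g x v w := by
  simp [← formL_apply]

theorem form_sub_left (x u v w : Coord n) : form g x (u - v) w = form g x u w - form g x v w := by
  simp [← formL_apply]

theorem form_zero_left (x w : Coord n) : form g x 0 w = 0 := by
  simp [← formL_apply]

theorem form_zero_right (x w : Coord n) : form g x w 0 = 0 := by
  simp [← formL_apply]

theorem form_single (x : Coord n) (i j : Fin n) :
    form g x (EuclideanSpace.single i 1) (EuclideanSpace.single j 1) = g x i j := by
  simp [form]

theorem dirDeriv_eq_sum_partialDeriv (f : Coord n → ℝ) (u x : Coord n) :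
    dirDeriv u f x = ∑ k, u k * partialDeriv k f x := by
  unfold dirDeriv partialDeriv
  conv_lhs => rw [← (EuclideanSpace.basisFun (Fin n) ℝ).sum_repr u]
  simp

namespace IsMetricOn

variable (hg : IsMetricOn g U)
include hg

theorem form_comm (hx : x ∈ U) (v w : Coord n) : form g x v w = form g x w v := by
  unfold form
  rw [Finset.sum_comm]
  refine Finset.sum_congr rfl fun i _ => Finset.sum_congr rfl fun j _ => ?_
  rw [hg.symm x hx]; ring

theorem eq_zero_of_form (hx : x ∈ U) {v : Coord n} (h : ∀ z, form g x v z = 0) : v = 0 := by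
  by_contra hv
  exact (hg.pos x hx v hv).ne' (h v)

theorem eq_of_form (hx : x ∈ U) {v w : Coord n} (h : ∀ z, form g x v z = form g x w z) :
    v = w := by
  refine sub_eq_zero.1 (hg.eq_zero_of_form hx fun z => ?_)
  rw [form_sub_left, h, sub_self]

theorem isUnit_det (hx : x ∈ U) : IsUnit (g x).det := by
  rw [isUnit_iff_ne_zero]
  intro h0
  obtain ⟨v, hv, hv0⟩ := Matrix.exists_mulVec_eq_zero_iff.2 h0
  have h1 := hg.pos x hx (WithLp.toLp 2 v) (fun h => hv (by simpa using h))
  have h2 : form g x (WithLp.toLp 2 v) (WithLp.toLp 2 v) = ∑ i, v i * (g x).mulVec v i := by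
    unfold form Matrix.mulVec dotProduct
    refine Finset.sum_congr rfl fun i _ => ?_
    rw [Finset.mul_sum]
    exact Finset.sum_congr rfl fun j _ => by ring
  rw [h2, hv0] at h1
  simp at h1

theorem contDiffOn_formL : ContDiffOn ℝ ∞ (formL g) U := by
  unfold formL
  exact ContDiffOn.sum fun i _ => ContDiffOn.sum fun j _ => contDiffOn_smul_vector (hg.smooth i j) _

theorem contDiffOn_form (v w : Coord n) : ContDiffOn ℝ ∞ (fun x => form g x v w) U := by
  simp only [← formL_apply]
  exact (hg.contDiffOn_formL.clm_apply contDiffOn_const).clm_apply contDiffOn_const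

omit hg in
theorem contDiffOn_det {m : ℕ} {A : Coord n → Matrix (Fin m) (Fin m) ℝ}
    (hA : ∀ i j, ContDiffOn ℝ ∞ (fun x => A x i j) U) : ContDiffOn ℝ ∞ (fun x => (A x).det) U := by
  simp only [Matrix.det_apply]
  exact ContDiffOn.sum fun σ _ => (contDiffOn_prod fun i _ => hA _ _).const_smul _

/-- Cramer's rule: each entry is a quotient of determinants, the denominator being nonzero by
positivity of the metric. -/
theorem contDiffOn_inv (i j : Fin n) : ContDiffOn ℝ ∞ (fun x => (g x)⁻¹ i j) U := by
  have h1 : ∀ x ∈ U, (g x)⁻¹ i j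
      = ((g x).det)⁻¹ * ((g x).updateRow j (Pi.single i 1)).det := fun x _ => by
    rw [Matrix.inv_def, Matrix.smul_apply, Matrix.adjugate_apply, Ring.inverse_eq_inv', smul_eq_mul]
  refine ContDiffOn.congr (ContDiffOn.mul ?_ ?_) h1
  · exact (contDiffOn_det hg.smooth).inv fun x hx => (hg.isUnit_det hx).ne_zero
  · refine contDiffOn_det fun k l => ?_
    by_cases hk : k = j
    · subst hk
      simpa using contDiffOn_const
    · simpa [Matrix.updateRow_ne hk] using hg.smooth k l

theorem contDiffOn_christoffel (h i j : Fin n) :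
    ContDiffOn ℝ ∞ (fun x => christoffel g x h i j) U := by
  have hp : ∀ k i j, ContDiffOn ℝ ∞ (fun x => partialDeriv k (fun z => g z i j) x) U :=
    fun k i j => contDiffOn_dirDeriv hg.isOpen (hg.smooth i j) _
  unfold christoffel
  exact contDiffOn_const.mul (ContDiffOn.sum fun k _ => (hg.contDiffOn_inv h k).mul
    (((hp _ _ _).add (hp _ _ _)).sub (hp _ _ _)))

theorem contDiffOn_christoffelL : ContDiffOn ℝ ∞ (christoffelL g) U := by
  unfold christoffelL
  exact ContDiffOn.sum fun h _ => ContDiffOn.sum fun i _ => ContDiffOn.sum fun j _ =>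
    contDiffOn_smul_vector (hg.contDiffOn_christoffel h i j) _

theorem dirDeriv_form (hx : x ∈ U) (u v w : Coord n) :
    dirDeriv u (fun y => form g y v w) x
      = ∑ i, ∑ j, ∑ k, partialDeriv k (fun y => g y i j) x * u k * v i * w j := by
  have hd : ∀ i j, DifferentiableAt ℝ (fun y => g y i j) x := fun i j =>
    differentiableAt_of_contDiffOn hg.isOpen (hg.smooth i j) hx
  have h1 : dirDeriv u (fun y => form g y v w) x
      = ∑ i, ∑ j, dirDeriv u (fun y => g y i j) x * v i * w j := by
    unfold dirDeriv form
    rw [fderiv_fun_sum fun i _ => DifferentiableAt.fun_sum fun j _ =>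
      ((hd i j).mul_const _).mul_const _, sum_apply]
    refine Finset.sum_congr rfl fun i _ => ?_
    rw [fderiv_fun_sum fun j _ => ((hd i j).mul_const _).mul_const _,
      sum_apply]
    refine Finset.sum_congr rfl fun j _ => ?_
    rw [fderiv_mul_const ((hd i j).mul_const _), fderiv_mul_const (hd i j)]
    simp
    ring
  rw [h1]
  refine Finset.sum_congr rfl fun i _ => Finset.sum_congr rfl fun j _ => ?_
  rw [dirDeriv_eq_sum_partialDeriv, Finset.sum_mul, Finset.sum_mul]
  exact Finset.sum_congr rfl fun k _ => by ring

theorem sum_mul_christoffel (hx : x ∈ U) (l i j : Fin n) :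
    ∑ h, g x h l * christoffel g x h i j = 1 / 2 *
      (partialDeriv i (fun z => g z j l) x + partialDeriv j (fun z => g z i l) x
        - partialDeriv l (fun z => g z i j) x) := by
  set T : Fin n → ℝ := fun k => partialDeriv i (fun z => g z j k) x
    + partialDeriv j (fun z => g z i k) x - partialDeriv k (fun z => g z i j) x with hT
  have h1 : ∑ h, g x h l * christoffel g x h i j
      = 1 / 2 * ∑ k, (∑ h, g x l h * (g x)⁻¹ h k) * T k := by
    simp only [Finset.sum_mul]
    rw [Finset.sum_comm, Finset.mul_sum]
    refine Finset.sum_congr rfl fun h _ => ?_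
    unfold christoffel
    rw [hg.symm x hx h l]
    simp only [Finset.mul_sum, hT]
    exact Finset.sum_congr rfl fun k _ => by ring
  rw [h1]
  congr 1
  have h2 : ∀ k, ∑ h, g x l h * (g x)⁻¹ h k = (1 : Matrix (Fin n) (Fin n) ℝ) l k := fun k => by
    rw [← Matrix.mul_apply, Matrix.mul_nonsing_inv _ (hg.isUnit_det hx)]
  simp only [h2, Matrix.one_apply, ite_mul, one_mul, zero_mul]
  simp [hT]

/-- The Koszul formula. -/
theorem form_christoffelL (hx : x ∈ U) (u v w : Coord n) :
    form g x (christoffelL g x u v) w = 1 / 2 * (dirDeriv u (fun y => form g y v w) x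
      + dirDeriv v (fun y => form g y u w) x - dirDeriv w (fun y => form g y u v) x) := by
  have h1 : form g x (christoffelL g x u v) w
      = ∑ l, ∑ i, ∑ j, (∑ h, g x h l * christoffel g x h i j) * u i * v j * w l := by
    unfold form
    simp only [christoffelL_apply]
    rw [Finset.sum_comm]
    refine Finset.sum_congr rfl fun l _ => ?_
    simp only [Finset.mul_sum, Finset.sum_mul]
    rw [Finset.sum_comm]
    refine Finset.sum_congr rfl fun i _ => ?_
    rw [Finset.sum_comm]
    exact Finset.sum_congr rfl fun j _ => Finset.sum_congr rfl fun h _ => by ring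
  have h2 : dirDeriv u (fun y => form g y v w) x
      = ∑ l, ∑ i, ∑ j, partialDeriv i (fun z => g z j l) x * u i * v j * w l := by
    rw [hg.dirDeriv_form hx, Finset.sum_comm]
    refine Finset.sum_congr rfl fun l _ => ?_
    rw [Finset.sum_comm]
  have h3 : dirDeriv v (fun y => form g y u w) x
      = ∑ l, ∑ i, ∑ j, partialDeriv j (fun z => g z i l) x * u i * v j * w l := by
    rw [hg.dirDeriv_form hx, Finset.sum_comm]
    exact Finset.sum_congr rfl fun l _ => Finset.sum_congr rfl fun i _ =>
      Finset.sum_congr rfl fun j _ => by ring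
  have h4 : dirDeriv w (fun y => form g y u v) x
      = ∑ l, ∑ i, ∑ j, partialDeriv l (fun z => g z i j) x * u i * v j * w l := by
    rw [hg.dirDeriv_form hx, Finset.sum_comm' (t' := Finset.univ) (s' := fun _ => Finset.univ)
      (by simp)]
    calc _ = ∑ j, ∑ k, ∑ i, partialDeriv k (fun z => g z i j) x * w k * u i * v j :=
          Finset.sum_congr rfl fun j _ => Finset.sum_comm
      _ = ∑ k, ∑ j, ∑ i, partialDeriv k (fun z => g z i j) x * w k * u i * v j := Finset.sum_comm
      _ = _ := Finset.sum_congr rfl fun l _ => by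
          rw [Finset.sum_comm]
          exact Finset.sum_congr rfl fun i _ => Finset.sum_congr rfl fun j _ => by ring
  rw [h1, h2, h3, h4]
  simp only [hg.sum_mul_christoffel hx, ← Finset.sum_add_distrib, ← Finset.sum_sub_distrib,
    Finset.mul_sum]
  exact Finset.sum_congr rfl fun l _ => Finset.sum_congr rfl fun i _ =>
    Finset.sum_congr rfl fun j _ => by ring

theorem dirDeriv_form_comm (hx : x ∈ U) (u v w : Coord n) :
    dirDeriv u (fun y => form g y v w) x = dirDeriv u (fun y => form g y w v) x :=
  dirDeriv_congr hg.isOpen (fun _ hy => hg.form_comm hy v w) hx u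

theorem christoffelL_comm (hx : x ∈ U) (u v : Coord n) :
    christoffelL g x u v = christoffelL g x v u := by
  refine hg.eq_of_form hx fun w => ?_
  rw [hg.form_christoffelL hx, hg.form_christoffelL hx, hg.dirDeriv_form_comm hx w u v]
  ring

/-- The connection is metric. -/
theorem dirDeriv_form_eq (hx : x ∈ U) (u v w : Coord n) :
    dirDeriv u (fun y => form g y v w) x
      = form g x (christoffelL g x u v) w + form g x v (christoffelL g x u w) := by
  rw [hg.form_comm hx v, hg.form_christoffelL hx, hg.form_christoffelL hx,
    hg.dirDeriv_form_comm hx u w v, hg.dirDeriv_form_comm hx v u w,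
    hg.dirDeriv_form_comm hx w u v]
  ring

theorem dirDeriv_christoffelL_apply (hx : x ∈ U) (s u v : Coord n) (h : Fin n) :
    dirDeriv s (christoffelL g) x u v h
      = ∑ i, ∑ j, ∑ k, partialDeriv k (fun y => christoffel g y h i j) x * s k * u i * v j := by
  have hd : ∀ i j, DifferentiableAt ℝ (fun y => christoffel g y h i j) x := fun i j =>
    differentiableAt_of_contDiffOn hg.isOpen (hg.contDiffOn_christoffel h i j) hx
  have hdL := differentiableAt_of_contDiffOn hg.isOpen hg.contDiffOn_christoffelL hx
  have h0 : dirDeriv s (christoffelL g) x u v h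
      = dirDeriv s (fun y => christoffelL g y u v h) x := by
    have h1 : dirDeriv s (fun y => christoffelL g y u v) x
        = dirDeriv s (christoffelL g) x u v := by
      rw [dirDeriv_clm_apply₂ hdL (differentiableAt_const u) (differentiableAt_const v),
        dirDeriv_const, dirDeriv_const]
      simp
    rw [← h1]
    have h2 := dirDeriv_clm_apply
      (differentiableAt_const (EuclideanSpace.proj h : Coord n →L[ℝ] ℝ))
      ((hdL.clm_apply (differentiableAt_const u)).clm_apply (differentiableAt_const v)) s
    rw [dirDeriv_const] at h2
    simpa using h2.symm
  rw [h0]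
  simp only [christoffelL_apply]
  have h1 : dirDeriv s (fun y => ∑ i, ∑ j, christoffel g y h i j * u i * v j) x
      = ∑ i, ∑ j, dirDeriv s (fun y => christoffel g y h i j) x * u i * v j := by
    unfold dirDeriv
    rw [fderiv_fun_sum fun i _ => DifferentiableAt.fun_sum fun j _ =>
      ((hd i j).mul_const _).mul_const _, sum_apply]
    refine Finset.sum_congr rfl fun i _ => ?_
    rw [fderiv_fun_sum fun j _ => ((hd i j).mul_const _).mul_const _,
      sum_apply]
    refine Finset.sum_congr rfl fun j _ => ?_
    rw [fderiv_mul_const ((hd i j).mul_const _), fderiv_mul_const (hd i j)]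
    simp
    ring
  rw [h1]
  refine Finset.sum_congr rfl fun i _ => Finset.sum_congr rfl fun j _ => ?_
  rw [dirDeriv_eq_sum_partialDeriv, Finset.sum_mul, Finset.sum_mul]
  exact Finset.sum_congr rfl fun k _ => by ring

theorem curvatureVector_eq (hx : x ∈ U) (u v w : Coord n) :
    curvatureVector g x u v w = dirDeriv u (christoffelL g) x v w
      - dirDeriv v (christoffelL g) x u w
      + (christoffelL g x u (christoffelL g x v w) - christoffelL g x v (christoffelL g x u w)) := by
  ext h
  simp only [PiLp.add_apply, PiLp.sub_apply, hg.dirDeriv_christoffelL_apply hx,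
    christoffelL_apply]
  have e1 : ∑ i, ∑ j, ∑ k, partialDeriv k (fun y => christoffel g y h i j) x * u k * v i * w j
      = ∑ k, ∑ i, ∑ j, partialDeriv i (fun y => christoffel g y h j k) x * u i * v j * w k := by
    rw [Finset.sum_comm]
    refine Finset.sum_congr rfl fun k _ => ?_
    rw [Finset.sum_comm]
  have e2 : ∑ i, ∑ j, ∑ k, partialDeriv k (fun y => christoffel g y h i j) x * v k * u i * w j
      = ∑ k, ∑ i, ∑ j, partialDeriv j (fun y => christoffel g y h i k) x * u i * v j * w k := by
    rw [Finset.sum_comm]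
    exact Finset.sum_congr rfl fun k _ => Finset.sum_congr rfl fun i _ =>
      Finset.sum_congr rfl fun j _ => by ring
  have e3 : ∀ a b : Coord n,
      ∑ i, ∑ l, christoffel g x h i l * a i * ∑ j, ∑ k, christoffel g x l j k * b j * w k
      = ∑ k, ∑ i, ∑ j, (∑ l, christoffel g x h i l * christoffel g x l j k) * a i * b j * w k := by
    intro a b
    have : ∀ i l, christoffel g x h i l * a i * ∑ j, ∑ k, christoffel g x l j k * b j * w k
        = ∑ k, ∑ j, christoffel g x h i l * christoffel g x l j k * a i * b j * w k := by
      intro i l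
      rw [Finset.sum_comm, Finset.mul_sum]
      refine Finset.sum_congr rfl fun k _ => ?_
      rw [Finset.mul_sum]
      exact Finset.sum_congr rfl fun j _ => by ring
    simp only [this, Finset.sum_mul]
    calc _ = ∑ i, ∑ k, ∑ l, ∑ j,
          christoffel g x h i l * christoffel g x l j k * a i * b j * w k :=
          Finset.sum_congr rfl fun i _ => Finset.sum_comm
      _ = ∑ k, ∑ i, ∑ l, ∑ j,
          christoffel g x h i l * christoffel g x l j k * a i * b j * w k := Finset.sum_comm
      _ = _ := Finset.sum_congr rfl fun k _ => Finset.sum_congr rfl fun i _ => Finset.sum_comm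
  have e4 : ∑ k, ∑ i, ∑ j,
        (∑ l, christoffel g x h i l * christoffel g x l j k) * v i * u j * w k
      = ∑ k, ∑ i, ∑ j,
        (∑ l, christoffel g x h j l * christoffel g x l i k) * u i * v j * w k := by
    refine Finset.sum_congr rfl fun k _ => ?_
    rw [Finset.sum_comm]
    exact Finset.sum_congr rfl fun i _ => Finset.sum_congr rfl fun j _ => by ring
  rw [e1, e2, e3, e3, e4]
  simp only [curvatureVector, ← Finset.sum_add_distrib, ← Finset.sum_sub_distrib]
  refine Finset.sum_congr rfl fun k _ => Finset.sum_congr rfl fun i _ =>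
    Finset.sum_congr rfl fun j _ => ?_
  unfold riemann
  rw [Finset.sum_sub_distrib]
  ring

theorem dirDeriv_formL_apply (hx : x ∈ U) (u v w : Coord n) :
    dirDeriv u (formL g) x v w = dirDeriv u (fun y => form g y v w) x := by
  have hd := differentiableAt_of_contDiffOn hg.isOpen hg.contDiffOn_formL hx
  have := dirDeriv_clm_apply₂ hd (differentiableAt_const v) (differentiableAt_const w) u
  simp only [formL_apply] at this
  rw [this, dirDeriv_const, dirDeriv_const]
  simp [form_zero_left, form_zero_right]

theorem dirDeriv_form_comp {H : Type*} [NormedAddCommGroup H] [NormedSpace ℝ H] {ψ f h : H → Coord n}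
    {q : H} (hq : ψ q ∈ U) (hψ : DifferentiableAt ℝ ψ q) (hf : DifferentiableAt ℝ f q)
    (hh : DifferentiableAt ℝ h q) (s : H) :
    dirDeriv s (fun y => form g (ψ y) (f y) (h y)) q
      = dirDeriv (dirDeriv s ψ q) (fun y => form g y (f q) (h q)) (ψ q)
        + form g (ψ q) (dirDeriv s f q) (h q) + form g (ψ q) (f q) (dirDeriv s h q) := by
  have hd := differentiableAt_of_contDiffOn hg.isOpen hg.contDiffOn_formL hq
  have := dirDeriv_clm_apply₂ (c := fun y => formL g (ψ y)) (hd.comp q hψ) hf hh s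
  rw [dirDeriv_comp hd hψ, hg.dirDeriv_formL_apply hq] at this
  simpa only [formL_apply] using this

theorem contDiffOn_christoffelL_apply (u v : Coord n) :
    ContDiffOn ℝ ∞ (fun y => christoffelL g y u v) U :=
  (hg.contDiffOn_christoffelL.clm_apply contDiffOn_const).clm_apply contDiffOn_const

theorem dirDeriv_christoffelL_const (hx : x ∈ U) (s u v : Coord n) :
    dirDeriv s (fun y => christoffelL g y u v) x = dirDeriv s (christoffelL g) x u v := by
  rw [dirDeriv_clm_apply₂ (differentiableAt_of_contDiffOn hg.isOpen hg.contDiffOn_christoffelL hx)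
    (differentiableAt_const u) (differentiableAt_const v), dirDeriv_const, dirDeriv_const]
  simp

/-- The Koszul formula differentiated once more; the two quadratic terms come from differentiating
the metric itself. -/
theorem form_dirDeriv_christoffelL (hx : x ∈ U) (u v w z : Coord n) :
    form g x (dirDeriv u (christoffelL g) x v w) z
      = 1 / 2 * (secondDeriv (form g) x u v w z + secondDeriv (form g) x u w v z
        - secondDeriv (form g) x u z v w)
        - form g x (christoffelL g x u (christoffelL g x v w)) z
        - form g x (christoffelL g x v w) (christoffelL g x u z) := by
  have hU := hg.isOpen
  have hs : ∀ a b c : Coord n, DifferentiableAt ℝ (dirDeriv a fun y => form g y b c) x :=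
    fun a b c => differentiableAt_of_contDiffOn hU
      (contDiffOn_dirDeriv hU (hg.contDiffOn_form b c) a) hx
  have h1 := dirDeriv_congr hU (fun y hy => hg.form_christoffelL hy v w z) hx u
  rw [hg.dirDeriv_form_comp (ψ := fun y => y) hx differentiableAt_id
    (differentiableAt_of_contDiffOn hU (hg.contDiffOn_christoffelL_apply v w) hx)
    (differentiableAt_const z), dirDeriv_const, form_zero_right,
    dirDeriv_const_mul (((hs _ _ _).fun_add (hs _ _ _)).fun_sub (hs _ _ _)),
    dirDeriv_sub ((hs _ _ _).fun_add (hs _ _ _)) (hs _ _ _), dirDeriv_add (hs _ _ _) (hs _ _ _),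
    hg.dirDeriv_christoffelL_const hx] at h1
  have h2 : dirDeriv u (fun y : Coord n => y) x = u := by simp [dirDeriv]
  rw [h2, hg.dirDeriv_form_eq hx] at h1
  unfold secondDeriv
  linarith

/-- Ties `curvComb` to the curvature at every point of the chart, not only at the centre of normal
coordinates; the derivative of the curvature at such a centre will be taken through this formula. -/
theorem two_mul_form_curvatureVector (hx : x ∈ U) (u v w z : Coord n) :
    2 * form g x (curvatureVector g x u v w) z = curvComb (form g) x u v w z
      + 2 * (form g x (christoffelL g x u w) (christoffelL g x v z)
        - form g x (christoffelL g x v w) (christoffelL g x u z)) := by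
  rw [hg.curvatureVector_eq hx, form_add_left, form_sub_left, form_sub_left,
    hg.form_dirDeriv_christoffelL hx, hg.form_dirDeriv_christoffelL hx]
  have h : secondDeriv (form g) x u v w z = secondDeriv (form g) x v u w z :=
    dirDeriv_comm hg.isOpen (hg.contDiffOn_form w z) hx u v
  unfold curvComb
  rw [h]
  ring

end IsMetricOn

/-- The curvature tensor at `x` is `R(u, v)w = c (g(v, w) u - g(u, w) v)`. -/
def SpaceFormAt (g : Coord n → Matrix (Fin n) (Fin n) ℝ) (x : Coord n) (c : ℝ) : Prop :=
  ∀ u v w, curvatureVector g x u v w = c • (form g x v w • u - form g x u w • v)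

theorem curvatureVector_single (x : Coord n) (h k i j : Fin n) :
    curvatureVector g x (EuclideanSpace.single i 1) (EuclideanSpace.single j 1)
      (EuclideanSpace.single k 1) h = riemann g x h k i j := by
  simp only [curvatureVector, PiLp.single_apply]
  rw [Finset.sum_eq_single k (by simp +contextual) (by simp),
    Finset.sum_eq_single i (by simp +contextual) (by simp),
    Finset.sum_eq_single j (by simp +contextual) (by simp)]
  simp

theorem SpaceFormAt.riemann_eq {c : ℝ} (hc : SpaceFormAt g x c) (h k i j : Fin n) :
    riemann g x h k i j = c * (g x j k * (1 : Matrix (Fin n) (Fin n) ℝ) h i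
      - g x i k * (1 : Matrix (Fin n) (Fin n) ℝ) h j) := by
  rw [← curvatureVector_single, hc]
  simp [form_single, Matrix.one_apply]

theorem IsMetricOn.gram_pos (hg : IsMetricOn g U) (hx : x ∈ U) {v w : Coord n}
    (hvw : LinearIndependent ℝ ![v, w]) :
    0 < form g x v v * form g x w w - form g x v w ^ 2 := by
  have hv0 := hg.pos x hx v (hvw.ne_zero 0)
  -- The Cauchy–Schwarz vector: its squared length is `g(v, v)` times the Gram determinant.
  have hne : form g x v v • w - form g x v w • v ≠ 0 := by
    intro h0
    have := (LinearIndependent.pair_iff.1 hvw) (-form g x v w) (form g x v v) (by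
      rw [← h0]; module)
    exact hv0.ne' this.2
  have h1 := hg.pos x hx _ hne
  simp only [sub_eq_add_neg, ← neg_smul, form_add_left, form_add_right, form_smul_left,
    form_smul_right] at h1
  rw [hg.form_comm hx w v] at h1
  have h2 : 0 < form g x v v * (form g x v v * form g x w w - form g x v w ^ 2) := by
    linarith
  exact pos_of_mul_pos_right h2 hv0.le

theorem SpaceFormAt.sectionalCurvature_eq (hg : IsMetricOn g U) (hx : x ∈ U) {c : ℝ}
    (hc : SpaceFormAt g x c) {v w : Coord n} (hvw : LinearIndependent ℝ ![v, w]) :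
    sectionalCurvature g x v w = c := by
  have hD := hg.gram_pos hx hvw
  unfold sectionalCurvature
  rw [hc, form_smul_left, form_sub_left, form_smul_left, form_smul_left, hg.form_comm hx w v]
  rw [div_eq_iff hD.ne']
  ring

/-! ### Change of coordinates -/

/-- `ψ` is a local isometry from `(U', g')` to `(U, g)`. -/
structure IsChange (g' g : Coord n → Matrix (Fin n) (Fin n) ℝ) (U' U : Set (Coord n))
    (ψ : Coord n → Coord n) : Prop where
  smooth : ContDiffOn ℝ ∞ ψ U'
  mapsTo : ∀ x ∈ U', ψ x ∈ U
  form_eq : ∀ x ∈ U', ∀ u v, form g' x u v = form g (ψ x) (dirDeriv u ψ x) (dirDeriv v ψ x)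
  surj : ∀ x ∈ U', ∀ y, ∃ u, dirDeriv u ψ x = y

namespace IsChange

variable {g' : Coord n → Matrix (Fin n) (Fin n) ℝ} {U' : Set (Coord n)} {ψ : Coord n → Coord n}
  (hψ : IsChange g' g U' U ψ) (hg' : IsMetricOn g' U') (hg : IsMetricOn g U)
include hψ hg'

theorem diff₀ (hx : x ∈ U') : DifferentiableAt ℝ ψ x :=
  differentiableAt_of_contDiffOn hg'.isOpen hψ.smooth hx

theorem diff₁ (hx : x ∈ U') (u : Coord n) : DifferentiableAt ℝ (dirDeriv u ψ) x :=
  differentiableAt_of_contDiffOn hg'.isOpen (contDiffOn_dirDeriv hg'.isOpen hψ.smooth u) hx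

theorem diff₂ (hx : x ∈ U') (u v : Coord n) :
    DifferentiableAt ℝ (dirDeriv u (dirDeriv v ψ)) x :=
  differentiableAt_of_contDiffOn hg'.isOpen (contDiffOn_dirDeriv hg'.isOpen
    (contDiffOn_dirDeriv hg'.isOpen hψ.smooth v) u) hx

include hg

/-- The transformation law of the Christoffel symbols. -/
theorem dirDeriv_christoffelL (hx : x ∈ U') (u v : Coord n) :
    dirDeriv (christoffelL g' x u v) ψ x
      = christoffelL g (ψ x) (dirDeriv u ψ x) (dirDeriv v ψ x) + dirDeriv u (dirDeriv v ψ) x := by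
  have hy := hψ.mapsTo x hx
  have hderiv : ∀ a b c, dirDeriv a (fun y => form g' y b c) x
      = dirDeriv (dirDeriv a ψ x) (fun y => form g y (dirDeriv b ψ x) (dirDeriv c ψ x)) (ψ x)
        + form g (ψ x) (dirDeriv a (dirDeriv b ψ) x) (dirDeriv c ψ x)
        + form g (ψ x) (dirDeriv b ψ x) (dirDeriv a (dirDeriv c ψ) x) := fun a b c => by
    rw [dirDeriv_congr hg'.isOpen (fun y hy => hψ.form_eq y hy b c) hx,
      hg.dirDeriv_form_comp hy (hψ.diff₀ hg' hx) (hψ.diff₁ hg' hx b)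
        (hψ.diff₁ hg' hx c)]
  have hcomm := fun a b => dirDeriv_comm hg'.isOpen hψ.smooth hx a b
  refine hg.eq_of_form hy fun z => ?_
  obtain ⟨w, rfl⟩ := hψ.surj x hx z
  rw [← hψ.form_eq x hx, hg'.form_christoffelL hx, hderiv, hderiv, hderiv, form_add_left,
    hg.form_christoffelL hy, hcomm w u, hcomm w v, hcomm v u,
    hg.form_comm hy (dirDeriv v ψ x)]
  ring

/-- The transformation law of the curvature tensor. -/
theorem dirDeriv_curvatureVector (hx : x ∈ U') (s u v : Coord n) :
    dirDeriv (curvatureVector g' x s u v) ψ x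
      = curvatureVector g (ψ x) (dirDeriv s ψ x) (dirDeriv u ψ x) (dirDeriv v ψ x) := by
  have hy := hψ.mapsTo x hx
  have hU' := hg'.isOpen
  have hcomm := fun a b => dirDeriv_comm hU' hψ.smooth hx a b
  have hcd : DifferentiableAt ℝ (christoffelL g) (ψ x) :=
    differentiableAt_of_contDiffOn hg.isOpen hg.contDiffOn_christoffelL hy
  -- Half of the curvature is transformed at a time. The non-tensorial remainder is symmetric in `s`
  -- and `u`, so it cancels when the two halves are subtracted.
  have key : ∀ s u, dirDeriv (dirDeriv s (christoffelL g') x u v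
        + christoffelL g' x s (christoffelL g' x u v)) ψ x
      = dirDeriv (dirDeriv s ψ x) (christoffelL g) (ψ x) (dirDeriv u ψ x) (dirDeriv v ψ x)
        + christoffelL g (ψ x) (dirDeriv s ψ x)
          (christoffelL g (ψ x) (dirDeriv u ψ x) (dirDeriv v ψ x))
        + (christoffelL g (ψ x) (dirDeriv s (dirDeriv u ψ) x) (dirDeriv v ψ x)
        + (christoffelL g (ψ x) (dirDeriv u ψ x) (dirDeriv s (dirDeriv v ψ) x)
        + christoffelL g (ψ x) (dirDeriv s ψ x) (dirDeriv u (dirDeriv v ψ) x))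
        + dirDeriv s (dirDeriv u (dirDeriv v ψ)) x) := by
    intro s u
    have hfd : DifferentiableAt ℝ (fderiv ℝ ψ) x :=
      differentiableAt_of_contDiffOn hU' (hψ.smooth.fderiv_of_isOpen hU' (by simp)) hx
    have h1 := dirDeriv_congr hU' (fun y hy => hψ.dirDeriv_christoffelL hg' hg hy u v) hx s
    have h2 := dirDeriv_clm_apply hfd (differentiableAt_of_contDiffOn hU'
      (hg'.contDiffOn_christoffelL_apply u v) hx) s
    have h3 : ∀ y, dirDeriv s (fderiv ℝ ψ) x y = dirDeriv s (dirDeriv y ψ) x := fun y => by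
      have := dirDeriv_clm_apply hfd (differentiableAt_const y) s
      rw [dirDeriv_const, map_zero, add_zero] at this
      exact this.symm
    have h4 : DifferentiableAt ℝ (fun y => christoffelL g (ψ y)) x :=
      differentiableAt_comp_fun (c := christoffelL g) hcd (hψ.diff₀ hg' hx)
    have hd1 := fun a => hψ.diff₁ hg' hx a
    rw [dirDeriv_add ((h4.clm_apply (hd1 u)).clm_apply (hd1 v)) (hψ.diff₂ hg' hx u v),
      dirDeriv_clm_apply₂ h4 (hd1 u) (hd1 v), dirDeriv_comp hcd (hψ.diff₀ hg' hx)] at h1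
    rw [h3, hg'.dirDeriv_christoffelL_const hx] at h2
    have h5 := hψ.dirDeriv_christoffelL hg' hg hx s (christoffelL g' x u v)
    rw [hψ.dirDeriv_christoffelL hg' hg hx u v, map_add] at h5
    have h6 : dirDeriv (dirDeriv s (christoffelL g') x u v) ψ x
        = dirDeriv s (fun y => dirDeriv (christoffelL g' y u v) ψ y) x
          - dirDeriv s (dirDeriv (christoffelL g' x u v) ψ) x := by
      rw [eq_sub_iff_add_eq, add_comm]
      exact h2.symm
    rw [dirDeriv_add_left, h6, h1, h5]
    abel
  have e1 : curvatureVector g' x s u v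
      = (dirDeriv s (christoffelL g') x u v + christoffelL g' x s (christoffelL g' x u v))
        - (dirDeriv u (christoffelL g') x s v + christoffelL g' x u (christoffelL g' x s v)) := by
    rw [hg'.curvatureVector_eq hx]; abel
  have e2 : ∀ a b : Coord n, dirDeriv (a - b) ψ x = dirDeriv a ψ x - dirDeriv b ψ x := by
    simp [dirDeriv]
  rw [e1, e2, key, key, hg.curvatureVector_eq hy, hcomm u s,
    dirDeriv_comm hU' (contDiffOn_dirDeriv hU' hψ.smooth v) hx u s]
  abel

theorem spaceFormAt (hx : x ∈ U') {c : ℝ} (hc : SpaceFormAt g' x c) : SpaceFormAt g (ψ x) c := by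
  intro u v w
  obtain ⟨u, rfl⟩ := hψ.surj x hx u
  obtain ⟨v, rfl⟩ := hψ.surj x hx v
  obtain ⟨w, rfl⟩ := hψ.surj x hx w
  rw [← hψ.dirDeriv_curvatureVector hg' hg hx, hc, ← hψ.form_eq x hx, ← hψ.form_eq x hx]
  simp [dirDeriv]

end IsChange

end LocalGeometry

/-! ### Second derivatives as multilinear maps -/

section Hessian

variable {F E E' X : Type*} [NormedAddCommGroup F] [NormedSpace ℝ F]
  [NormedAddCommGroup E] [NormedSpace ℝ E] [NormedAddCommGroup E'] [NormedSpace ℝ E']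
  [NormedAddCommGroup X] [NormedSpace ℝ X]

/-- The second derivative of a function as a bilinear map. -/
def hessian (f : F → X) (x : F) : F →ₗ[ℝ] F →ₗ[ℝ] X :=
  LinearMap.mk₂ ℝ (fun a b => fderiv ℝ (fderiv ℝ f) x a b) (by simp) (by simp) (by simp) (by simp)

theorem dirDeriv_dirDeriv_eq_hessian {f : F → X} {W : Set F} (hW : IsOpen W)
    (hf : ContDiffOn ℝ ∞ f W) {q : F} (hq : q ∈ W) (a b : F) :
    dirDeriv a (dirDeriv b f) q = hessian f q a b := dirDeriv_dirDeriv hW hf hq a b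

/-- The second derivative of a function with values in bilinear forms, as a quadrilinear form. -/
def bilinHessian (f : F → E →L[ℝ] E' →L[ℝ] ℝ) (x : F) : F →ₗ[ℝ] F →ₗ[ℝ] E →ₗ[ℝ] E' →ₗ[ℝ] ℝ :=
  LinearMap.mk₂ ℝ (fun a b => LinearMap.mk₂ ℝ (fun c d => hessian f x a b c d)
      (by simp) (by simp) (by simp) (by simp))
    (fun a a' b => by ext; simp) (fun r a b => by ext; simp) (fun a b b' => by ext; simp)
    (fun r a b => by ext; simp)

theorem bilinHessian_apply (f : F → E →L[ℝ] E' →L[ℝ] ℝ) (x a b : F) (c : E) (d : E') :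
    bilinHessian f x a b c d = hessian f x a b c d := rfl

end Hessian

/-! ### The 2-jet of the lifted metric at the zero section -/

section LiftJet

variable {n : ℕ} {g : Coord n → Matrix (Fin n) (Fin n) ℝ} {U : Set (Coord n)} {x : Coord n}

/-- The second derivative of the metric as a quadrilinear form. -/
def metricHess (g : Coord n → Matrix (Fin n) (Fin n) ℝ) (x : Coord n) :
    Coord n →ₗ[ℝ] Coord n →ₗ[ℝ] Coord n →ₗ[ℝ] Coord n →ₗ[ℝ] ℝ :=
  bilinHessian (formL g) x

namespace IsMetricOn

variable (hg : IsMetricOn g U)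
include hg

theorem secondDeriv_form (hx : x ∈ U) (a b c d : Coord n) :
    secondDeriv (form g) x a b c d = metricHess g x a b c d := by
  have hU := hg.isOpen
  have hd : DifferentiableAt ℝ (dirDeriv b (formL g)) x := differentiableAt_of_contDiffOn hU
    (contDiffOn_dirDeriv hU hg.contDiffOn_formL b) hx
  have h1 : Set.EqOn (dirDeriv b fun y => form g y c d) (fun y => dirDeriv b (formL g) y c d) U :=
    fun y hy => (hg.dirDeriv_formL_apply hy b c d).symm
  unfold secondDeriv metricHess
  rw [dirDeriv_congr hU h1 hx, dirDeriv_clm_apply₂ hd (differentiableAt_const c)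
    (differentiableAt_const d), dirDeriv_const, dirDeriv_const,
    dirDeriv_dirDeriv_eq_hessian hU hg.contDiffOn_formL hx, bilinHessian_apply]
  simp

theorem metricHess_comm_left (hx : x ∈ U) (a b c d : Coord n) :
    metricHess g x a b c d = metricHess g x b a c d := by
  rw [← hg.secondDeriv_form hx, ← hg.secondDeriv_form hx]
  exact dirDeriv_comm hg.isOpen (hg.contDiffOn_form c d) hx a b

theorem metricHess_comm_right (hx : x ∈ U) (a b c d : Coord n) :
    metricHess g x a b c d = metricHess g x a b d c := by
  rw [← hg.secondDeriv_form hx, ← hg.secondDeriv_form hx]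
  exact dirDeriv_congr hg.isOpen (fun y hy => hg.dirDeriv_form_comm hy b c d) hx a

end IsMetricOn

/-- The derivative of the lowered Christoffel symbols in coordinates that are normal at `x`. -/
def christoffelHess (g : Coord n → Matrix (Fin n) (Fin n) ℝ) (x a b c d : Coord n) : ℝ :=
  1 / 2 * (metricHess g x a b c d + metricHess g x a c b d - metricHess g x a d b c)

/-- The coordinates are normal to first order at `x`. -/
def IsNormalAt (g : Coord n → Matrix (Fin n) (Fin n) ℝ) (x : Coord n) : Prop :=
  ∀ u v w, dirDeriv u (fun y => form g y v w) x = 0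

theorem IsNormalAt.christoffelL_eq_zero (hN : IsNormalAt g x) (hg : IsMetricOn g U) (hx : x ∈ U)
    (u v : Coord n) : christoffelL g x u v = 0 :=
  hg.eq_zero_of_form hx fun w => by rw [hg.form_christoffelL hx, hN, hN, hN]; ring

theorem verticalPart_eq (x y : Coord n) (X : Coord n × Coord n) :
    verticalPart g (x, y) X = X.2 + christoffelL g x y X.1 := by
  ext h
  rw [PiLp.add_apply, christoffelL_apply]
  simp only [verticalPart]
  congr 1
  exact Finset.sum_congr rfl fun k _ => Finset.sum_congr rfl fun i _ => by ring

theorem liftedMetric_zero (a : Coefficients) (x : Coord n) (X Y : Coord n × Coord n) :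
    liftedMetric a g (x, 0) X Y = a.c₁ 0 * form g x X.1 Y.1 + a.c₂ 0 * form g x X.2 Y.2
      + a.c₃ 0 * (form g x X.1 Y.2 + form g x X.2 Y.1) := by
  simp only [liftedMetric, block, energy, verticalPart_eq, form_zero_left, map_zero,
    zero_apply, add_zero, mul_zero]
  ring

/-- The coordinate line of `TM` through the zero vector at `x` in the direction `A`. -/
abbrev fibreLine (x : Coord n) (A : Coord n × Coord n) (s : ℝ) : Coord n × Coord n :=
  (x + s • A.1, s • A.2)

section Taylor

variable (hg : IsMetricOn g U) (hx : x ∈ U) (A : Coord n × Coord n)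
include hg hx

theorem eventually_line_mem (v : Coord n) : ∀ᶠ s : ℝ in 𝓝 0, x + s • v ∈ U := by
  have hc : Continuous fun s : ℝ => x + s • v := by fun_prop
  exact hc.continuousAt.eventually_mem (hg.isOpen.mem_nhds (by simpa using hx))

theorem tendsto_form_line (a : Coord n) {f h : Coord n → Coord n} (hf : ContDiffOn ℝ ∞ f U)
    (hh : ContDiffOn ℝ ∞ h U) :
    Tendsto (fun s : ℝ => form g (x + s • a) (f (x + s • a)) (h (x + s • a))) (𝓝 0)
      (𝓝 (form g x (f x) (h x))) := by
  have h1 : ContDiffOn ℝ ∞ (fun y => form g y (f y) (h y)) U := by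
    simp only [← formL_apply]
    exact (hg.contDiffOn_formL.clm_apply hf).clm_apply hh
  have h2 : ContinuousAt (fun y => form g y (f y) (h y)) (x + (0 : ℝ) • a) :=
    (differentiableAt_of_contDiffOn hg.isOpen h1 (by simpa using hx)).continuousAt
  have h3 : ContinuousAt (fun s : ℝ => x + s • a) 0 := by fun_prop
  have h4 := ContinuousAt.comp (f := fun s : ℝ => x + s • a) (x := (0 : ℝ)) h2 h3
  unfold ContinuousAt at h4
  simpa [Function.comp_def] using h4

theorem taylorTwo_form (v w : Coord n) : TaylorTwo (fun s => form g (x + s • A.1) v w)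
    (form g x v w) (dirDeriv A.1 (fun y => form g y v w) x)
    (metricHess g x A.1 A.1 v w / 2) :=
  (TaylorTwo.of_contDiffOn hg.isOpen (hg.contDiffOn_form v w) hx A.1).congr (fun _ => rfl) rfl rfl
    (by rw [← hg.secondDeriv_form hx]; rfl)

/-- The Christoffel symbols vanish at `x`, so together with the factor `s` coming from the fibre
coordinate they contribute only at second order. -/
theorem taylorTwo_christoffel_normal (hN : IsNormalAt g x) (u v w : Coord n) :
    TaylorTwo (fun s => s * form g (x + s • A.1) (christoffelL g (x + s • A.1) u v) w)
      0 0 (christoffelHess g x A.1 u v w) := by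
  have h1 : ContDiffOn ℝ ∞ (fun y => form g y (christoffelL g y u v) w) U := by
    simp only [← formL_apply]
    exact (hg.contDiffOn_formL.clm_apply (hg.contDiffOn_christoffelL_apply u v)).clm_apply
      contDiffOn_const
  have h0 : form g x (christoffelL g x u v) w = 0 := by
    rw [hN.christoffelL_eq_zero hg hx, form_zero_left]
  have h2 : dirDeriv A.1 (fun y => form g y (christoffelL g y u v) w) x
      = christoffelHess g x A.1 u v w := by
    have h3 : dirDeriv A.1 (fun y : Coord n => y) x = A.1 := by simp [dirDeriv]
    rw [hg.dirDeriv_form_comp (ψ := fun y => y) hx differentiableAt_id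
      (differentiableAt_of_contDiffOn hg.isOpen (hg.contDiffOn_christoffelL_apply u v) hx)
      (differentiableAt_const w), dirDeriv_const, form_zero_right, h3,
      hg.dirDeriv_christoffelL_const hx, hN, hg.form_dirDeriv_christoffelL hx,
      hN.christoffelL_eq_zero hg hx u v, map_zero, form_zero_left, form_zero_left,
      hg.secondDeriv_form hx, hg.secondDeriv_form hx, hg.secondDeriv_form hx]
    unfold christoffelHess
    ring
  have h3 : HasDerivAt (fun s : ℝ => x + s • A.1) A.1 0 := by
    simpa using ((hasDerivAt_id (0 : ℝ)).smul_const A.1).const_add x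
  have h4 : HasDerivAt (fun s : ℝ => form g (x + s • A.1) (christoffelL g (x + s • A.1) u v) w)
      (dirDeriv A.1 (fun y => form g y (christoffelL g y u v) w) (x + (0 : ℝ) • A.1)) 0 :=
    (differentiableAt_of_contDiffOn hg.isOpen h1 (by simpa using hx)).hasFDerivAt.comp_hasDerivAt
      0 h3
  refine (TaylorTwo.of_hasDerivAt_mul h4).congr (fun _ => rfl) rfl (by simpa using h0) ?_
  rw [zero_smul, add_zero, h2]

theorem taylorTwo_christoffel_sq (hN : IsNormalAt g x) (u v u' v' : Coord n) :
    TaylorTwo (fun s => s ^ 2 * form g (x + s • A.1) (christoffelL g (x + s • A.1) u v)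
      (christoffelL g (x + s • A.1) u' v')) 0 0 0 := by
  refine TaylorTwo.of_tendsto ?_
  have := tendsto_form_line hg hx A.1 (hg.contDiffOn_christoffelL_apply u v)
    (hg.contDiffOn_christoffelL_apply u' v')
  rwa [hN.christoffelL_eq_zero hg hx u v, form_zero_left] at this

theorem taylorTwo_coefficient {c : ℝ → ℝ} (hc : ContDiffOn ℝ ∞ c (Set.Ici 0)) :
    TaylorTwo (fun s => c (energy g (fibreLine x A s))) (c 0) 0
      (derivWithin c (Set.Ici 0) 0 * (form g x A.2 A.2 / 2)) := by
  have h1 : HasDerivWithinAt c (derivWithin c (Set.Ici 0) 0) (Set.Ici 0) 0 :=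
    ((hc.differentiableOn (by simp)) 0 (Set.mem_Ici.2 le_rfl)).hasDerivWithinAt
  have h2 := (tendsto_form_line hg hx A.1 (f := fun _ => A.2) (h := fun _ => A.2)
    contDiffOn_const contDiffOn_const).div_const 2
  have h3 : ∀ᶠ s : ℝ in 𝓝 0, 0 ≤ form g (x + s • A.1) A.2 A.2 / 2 := by
    filter_upwards [eventually_line_mem hg hx A.1] with s hs
    by_cases h0 : A.2 = 0
    · simp [h0, form_zero_left]
    · exact div_nonneg (hg.pos _ hs _ h0).le (by norm_num)
  refine (TaylorTwo.comp_sq h1 h2 h3).congr (fun s => ?_) rfl rfl rfl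
  simp only [energy, form_smul_left, form_smul_right]
  congr 1
  ring

/-- Along the line the fibre coordinate is `s A.2`, so the `d` part carries a factor `s²` and only
the constant terms `Q₀`, `R₀` matter; the energy is also of order `s²`, so `c` contributes its
derivative against `P₀` only. -/
theorem taylorTwo_block {c d : ℝ → ℝ} (hc : ContDiffOn ℝ ∞ c (Set.Ici 0))
    (hd : ContDiffOn ℝ ∞ d (Set.Ici 0)) {v w : ℝ → Coord n} {P₀ P₁ P₂ Q₀ Q₁ Q₂ R₀ R₁ R₂ : ℝ}
    (hP : TaylorTwo (fun s => form g (x + s • A.1) (v s) (w s)) P₀ P₁ P₂)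
    (hQ : TaylorTwo (fun s => form g (x + s • A.1) A.2 (v s)) Q₀ Q₁ Q₂)
    (hR : TaylorTwo (fun s => form g (x + s • A.1) A.2 (w s)) R₀ R₁ R₂) :
    TaylorTwo (fun s => block g c d (fibreLine x A s) (v s) (w s)) (c 0 * P₀) (c 0 * P₁)
      (c 0 * P₂ + derivWithin c (Set.Ici 0) 0 * (form g x A.2 A.2 / 2) * P₀
        + d 0 * Q₀ * R₀) := by
  have hc' := taylorTwo_coefficient hg hx A hc
  have hd' := taylorTwo_coefficient hg hx A hd
  refine ((hc'.mul hP).add (hd'.mul ((TaylorTwo.id.mul hQ).mul (TaylorTwo.id.mul hR)))).congr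
    (fun s => ?_) (by ring) (by ring) (by ring)
  simp only [block, fibreLine, form_smul_left]
  ring

end Taylor

/-- The contribution of the functions `c`, `d` to the second fibre derivative at the zero
section, where `c'` is the derivative of `c` at zero. -/
def fibreJet (g : Coord n → Matrix (Fin n) (Fin n) ℝ) (x : Coord n) (c' d : ℝ)
    (a b w z : Coord n) : ℝ :=
  c' * form g x a b * form g x w z
    + d * (form g x a w * form g x b z + form g x b w * form g x a z)

/-- The second derivatives of the lifted metric at the zero section, in normal coordinates. -/
def liftHess (a : Coefficients) (g : Coord n → Matrix (Fin n) (Fin n) ℝ) (x : Coord n)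
    (A B X Y : Coord n × Coord n) : ℝ :=
  a.c₁ 0 * metricHess g x A.1 B.1 X.1 Y.1 + a.c₂ 0 * metricHess g x A.1 B.1 X.2 Y.2
    + a.c₃ 0 * (metricHess g x A.1 B.1 X.1 Y.2 + metricHess g x A.1 B.1 X.2 Y.1)
    + a.c₂ 0 * (christoffelHess g x A.1 B.2 X.1 Y.2 + christoffelHess g x B.1 A.2 X.1 Y.2
      + christoffelHess g x A.1 B.2 Y.1 X.2 + christoffelHess g x B.1 A.2 Y.1 X.2)
    + a.c₃ 0 * (metricHess g x A.1 B.2 X.1 Y.1 + metricHess g x B.1 A.2 X.1 Y.1)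
    + fibreJet g x (derivWithin a.c₁ (Set.Ici 0) 0) (a.d₁ 0) A.2 B.2 X.1 Y.1
    + fibreJet g x (derivWithin a.c₂ (Set.Ici 0) 0) (a.d₂ 0) A.2 B.2 X.2 Y.2
    + fibreJet g x (derivWithin a.c₃ (Set.Ici 0) 0) (a.d₃ 0) A.2 B.2 X.1 Y.2
    + fibreJet g x (derivWithin a.c₃ (Set.Ici 0) 0) (a.d₃ 0) A.2 B.2 X.2 Y.1

/-- Expand each of the four blocks along the line. In normal coordinates the vertical part of a
vector is its fibre component plus a term of order `s²`, which is why nothing of first order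
appears. -/
theorem taylorTwo_liftedMetric (a : Coefficients) (hg : IsMetricOn g U) (hx : x ∈ U)
    (hN : IsNormalAt g x) (A X Y : Coord n × Coord n) :
    TaylorTwo (fun s => liftedMetric a g (fibreLine x A s) X Y)
      (liftedMetric a g (x, 0) X Y) 0 (liftHess a g x A A X Y / 2) := by
  have hvp : ∀ (s : ℝ) (X : Coord n × Coord n), verticalPart g (fibreLine x A s) X
      = X.2 + s • christoffelL g (x + s • A.1) A.2 X.1 := fun s X => by
    simp [fibreLine, verticalPart_eq]
  have T0 : ∀ v w : Coord n, TaylorTwo (fun s => form g (x + s • A.1) v w) (form g x v w) 0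
      (metricHess g x A.1 A.1 v w / 2) := fun v w =>
    (taylorTwo_form hg hx A v w).congr (fun _ => rfl) rfl (hN _ _ _) rfl
  have T1 := taylorTwo_christoffel_normal hg hx A hN
  have TL : ∀ (v : Coord n) (X : Coord n × Coord n),
      TaylorTwo (fun s => form g (x + s • A.1) (verticalPart g (fibreLine x A s) X) v)
        (form g x X.2 v) 0 (metricHess g x A.1 A.1 X.2 v / 2
          + christoffelHess g x A.1 A.2 X.1 v) := fun v X =>
    ((T0 X.2 v).add (T1 A.2 X.1 v)).congr
      (fun s => by rw [hvp, form_add_left, form_smul_left]) (by ring) (by ring) (by ring)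
  have comm : ∀ {p q r : ℝ} {v w : ℝ → Coord n},
      TaylorTwo (fun s => form g (x + s • A.1) (v s) (w s)) p q r →
      TaylorTwo (fun s => form g (x + s • A.1) (w s) (v s)) p q r := by
    intro p q r v w h
    refine IsLittleO.congr' h ?_ EventuallyEq.rfl
    filter_upwards [eventually_line_mem hg hx A.1] with s hs
    rw [hg.form_comm hs]
  have TR : ∀ (v : Coord n) (X : Coord n × Coord n),
      TaylorTwo (fun s => form g (x + s • A.1) v (verticalPart g (fibreLine x A s) X))
        (form g x v X.2) 0 (metricHess g x A.1 A.1 v X.2 / 2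
          + christoffelHess g x A.1 A.2 X.1 v) := fun v X =>
    (comm (TL v X)).congr (fun _ => rfl) (hg.form_comm hx _ _) rfl
      (by rw [hg.metricHess_comm_right hx])
  have TLR : TaylorTwo (fun s => form g (x + s • A.1) (verticalPart g (fibreLine x A s) X)
      (verticalPart g (fibreLine x A s) Y)) (form g x X.2 Y.2) 0
      (metricHess g x A.1 A.1 X.2 Y.2 / 2 + christoffelHess g x A.1 A.2 Y.1 X.2
        + christoffelHess g x A.1 A.2 X.1 Y.2) := by
    refine (((TR X.2 Y).add (T1 A.2 X.1 Y.2)).add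
      (taylorTwo_christoffel_sq hg hx A hN A.2 X.1 A.2 Y.1)).congr (fun s => ?_)
      (by ring) (by ring) (by ring)
    rw [hvp s X, form_add_left, form_smul_left, hvp s Y]
    simp only [form_add_right, form_smul_right]
    ring
  have B1 := taylorTwo_block hg hx A a.smooth_c₁ a.smooth_d₁ (v := fun _ => X.1) (w := fun _ => Y.1)
    (T0 X.1 Y.1) (T0 A.2 X.1) (T0 A.2 Y.1)
  have B2 := taylorTwo_block hg hx A a.smooth_c₂ a.smooth_d₂ TLR (TR A.2 X) (TR A.2 Y)
  have B3 := taylorTwo_block hg hx A a.smooth_c₃ a.smooth_d₃ (v := fun _ => X.1)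
    (TR X.1 Y) (T0 A.2 X.1) (TR A.2 Y)
  have B4 := taylorTwo_block hg hx A a.smooth_c₃ a.smooth_d₃ (w := fun _ => Y.1)
    (TL Y.1 X) (TR A.2 X) (T0 A.2 Y.1)
  refine (((B1.add B2).add B3).add B4).congr (fun s => rfl) ?_ (by ring) ?_
  · rw [liftedMetric_zero]; ring
  · unfold liftHess fibreJet christoffelHess
    rw [hg.metricHess_comm_right hx A.1 A.2 Y.1 X.1]
    ring

theorem line_eq_fibreLine (x : Coord n) (A : Coord n × Coord n) (s : ℝ) :
    (x, (0 : Coord n)) + s • A = fibreLine x A s :=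
  Prod.ext rfl (zero_add _)

section Smooth

variable {a : Coefficients} {W : Set (Coord n × Coord n)} (hg : IsMetricOn g U) (hx : x ∈ U)
  (hW : IsOpen W) (hxW : (x, 0) ∈ W)
  (hGW : ∀ X Y, ContDiffOn ℝ ∞ (fun p => liftedMetric a g p X Y) W)
include hg hx hW hxW hGW

/-- The two mixed blocks give `c₃(0) (g(Γ(s, w), z) + g(w, Γ(s, z)))`, which metric compatibility
turns into a derivative of `g`. Normality at `x` is not assumed, so the identity holds along the
zero section and can itself be differentiated in `x`. -/
theorem dirDeriv_liftedMetric_fibre (s w z : Coord n) :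
    dirDeriv (0, s) (fun p => liftedMetric a g p (w, 0) (z, 0)) (x, 0)
      = a.c₃ 0 * dirDeriv s (fun y => form g y w z) x := by
  set A : Coord n × Coord n := (0, s) with hA
  have h1 := TaylorTwo.of_contDiffOn hW (hGW (w, 0) (z, 0)) hxW A
  have hvp : ∀ (r : ℝ) (v : Coord n), verticalPart g (fibreLine x A r) (v, 0)
      = r • christoffelL g x s v := fun r v => by simp [fibreLine, verticalPart_eq, hA]
  have hl : ∀ r : ℝ, x + r • A.1 = x := fun r => by simp [hA]
  have T : ∀ u v : Coord n, TaylorTwo (fun r => form g (x + r • A.1) u v) (form g x u v) 0 0 :=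
    fun u v => (TaylorTwo.const _).congr (fun r => by rw [hl]) rfl rfl rfl
  have TR : ∀ u v : Coord n,
      TaylorTwo (fun r => form g (x + r • A.1) u (verticalPart g (fibreLine x A r) (v, 0))) 0
        (form g x u (christoffelL g x s v)) 0 := fun u v =>
    ((TaylorTwo.const _).mul TaylorTwo.id).congr
      (fun r => by rw [hl, hvp, form_smul_right, mul_comm]) (by ring) (by ring) (by ring)
  have TL : ∀ u v : Coord n,
      TaylorTwo (fun r => form g (x + r • A.1) (verticalPart g (fibreLine x A r) (v, 0)) u) 0
        (form g x (christoffelL g x s v) u) 0 := fun u v =>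
    ((TaylorTwo.const _).mul TaylorTwo.id).congr
      (fun r => by rw [hl, hvp, form_smul_left, mul_comm]) (by ring) (by ring) (by ring)
  have TLR : TaylorTwo (fun r => form g (x + r • A.1) (verticalPart g (fibreLine x A r) (w, 0))
      (verticalPart g (fibreLine x A r) (z, 0))) 0 0
      (form g x (christoffelL g x s w) (christoffelL g x s z)) :=
    ((TaylorTwo.const _).mul (TaylorTwo.id.mul TaylorTwo.id)).congr
      (fun r => by rw [hl, hvp, hvp, form_smul_left, form_smul_right]; ring)
      (by ring) (by ring) (by ring)
  have B1 := taylorTwo_block hg hx A a.smooth_c₁ a.smooth_d₁ (v := fun _ => w) (w := fun _ => z)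
    (T w z) (T A.2 w) (T A.2 z)
  have B2 := taylorTwo_block hg hx A a.smooth_c₂ a.smooth_d₂ TLR (TR A.2 w) (TR A.2 z)
  have B3 := taylorTwo_block hg hx A a.smooth_c₃ a.smooth_d₃ (v := fun _ => w)
    (TR w z) (T A.2 w) (TR A.2 z)
  have B4 := taylorTwo_block hg hx A a.smooth_c₃ a.smooth_d₃ (w := fun _ => z)
    (TL z w) (TR A.2 w) (T A.2 z)
  have h2 := (((B1.add B2).add B3).add B4).congr
    (h := fun r => liftedMetric a g ((x, 0) + r • A) (w, 0) (z, 0))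
    (fun r => by rw [line_eq_fibreLine]; rfl) rfl rfl rfl
  rw [(h1.unique h2).2.1, hg.dirDeriv_form_eq hx]
  ring

variable (hN : IsNormalAt g x)
include hN

theorem dirDeriv_liftedMetric_eq_zero (A X Y : Coord n × Coord n) :
    dirDeriv A (fun p => liftedMetric a g p X Y) (x, 0) = 0 := by
  have h1 := TaylorTwo.of_contDiffOn hW (hGW X Y) hxW A
  have h2 := taylorTwo_liftedMetric a hg hx hN A X Y
  simp only [← line_eq_fibreLine] at h2
  exact (h1.unique h2).2.1

theorem secondDeriv_liftedMetric (A B X Y : Coord n × Coord n) :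
    secondDeriv (liftedMetric a g) (x, 0) A B X Y = liftHess a g x A B X Y := by
  have diag : ∀ A, fderiv ℝ (fderiv ℝ (fun p => liftedMetric a g p X Y)) (x, 0) A A
      = liftHess a g x A A X Y := fun A => by
    have h1 := TaylorTwo.of_contDiffOn hW (hGW X Y) hxW A
    have h2 := taylorTwo_liftedMetric a hg hx hN A X Y
    simp only [← line_eq_fibreLine] at h2
    have h3 := (h1.unique h2).2.2
    rw [dirDeriv_dirDeriv hW (hGW X Y) hxW] at h3
    linarith
  have symm : ∀ A B, fderiv ℝ (fderiv ℝ (fun p => liftedMetric a g p X Y)) (x, 0) A B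
      = fderiv ℝ (fderiv ℝ (fun p => liftedMetric a g p X Y)) (x, 0) B A := fun A B => by
    rw [← dirDeriv_dirDeriv hW (hGW X Y) hxW, ← dirDeriv_dirDeriv hW (hGW X Y) hxW]
    exact dirDeriv_comm hW (hGW X Y) hxW A B
  unfold secondDeriv
  rw [dirDeriv_dirDeriv hW (hGW X Y) hxW]
  have h1 := diag A
  have h2 := diag B
  have h3 := diag (A + B)
  have h4 := symm B A
  simp only [map_add, add_apply] at h3
  -- Polarization: the expansions along lines give only the diagonal of the second derivative.
  have h5 : liftHess a g x (A + B) (A + B) X Y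
      = liftHess a g x A A X Y + liftHess a g x B B X Y + 2 * liftHess a g x A B X Y := by
    unfold liftHess fibreJet christoffelHess
    simp only [Prod.fst_add, Prod.snd_add, map_add, LinearMap.add_apply, form_add_left,
      form_add_right]
    rw [hg.form_comm hx B.2 A.2]
    simp only [hg.metricHess_comm_left hx B.1 A.1]
    ring
  linarith

end Smooth

end LiftJet

/-! ### Conformal flatness of the lift restricts the curvature of the base -/

section ConformallyFlatLift

variable {n : ℕ} {g : Coord n → Matrix (Fin n) (Fin n) ℝ} {U : Set (Coord n)} {x : Coord n}
  {a : Coefficients}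

theorem IsMetricOn.curvComb_form (hg : IsMetricOn g U) (hx : x ∈ U) (u v w z : Coord n) :
    curvComb (form g) x u v w z = metricHess g x u w v z + metricHess g x v z u w
      - metricHess g x u z v w - metricHess g x v w u z := by
  unfold curvComb
  simp only [hg.secondDeriv_form hx]

/-- In normal coordinates the curvature is given by the second derivatives of the metric. -/
theorem IsNormalAt.spaceFormAt (hN : IsNormalAt g x) (hg : IsMetricOn g U) (hx : x ∈ U) {c : ℝ}
    (h : ∀ u v w z, metricHess g x u w v z + metricHess g x v z u w - metricHess g x u z v w
      - metricHess g x v w u z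
      = 2 * c * (form g x v w * form g x u z - form g x u w * form g x v z)) :
    SpaceFormAt g x c := by
  intro u v w
  refine hg.eq_of_form hx fun z => ?_
  have h1 := hg.two_mul_form_curvatureVector hx u v w z
  rw [hg.curvComb_form hx, h, hN.christoffelL_eq_zero hg hx u w,
    hN.christoffelL_eq_zero hg hx v w, form_zero_left, form_zero_left] at h1
  rw [form_smul_left, form_sub_left, form_smul_left, form_smul_left]
  linarith

/-- The curvature of the base when `c₂(0) ≠ 0`. -/
def curvatureConst₂ (a : Coefficients) : ℝ :=
  ((a.c₃ 0 / a.c₂ 0) ^ 2 * (derivWithin a.c₂ (Set.Ici 0) 0 - a.d₂ 0)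
    - a.c₃ 0 / a.c₂ 0 * (derivWithin a.c₃ (Set.Ici 0) 0 - a.d₃ 0)) / a.c₂ 0

/-- The curvature of the base when `c₂(0) = 0` and `c₁(0) ≠ 0`. -/
def curvatureConst₁ (a : Coefficients) : ℝ :=
  -((a.c₁ 0 / (2 * a.c₃ 0)) ^ 2 * (derivWithin a.c₁ (Set.Ici 0) 0 - a.d₁ 0)
    - 2 * (a.c₁ 0 / (2 * a.c₃ 0)) ^ 3 * (derivWithin a.c₃ (Set.Ici 0) 0 - a.d₃ 0)
    + (a.c₁ 0 / (2 * a.c₃ 0)) ^ 4 * (derivWithin a.c₂ (Set.Ici 0) 0 - a.d₂ 0)) / a.c₁ 0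

variable (hg : IsMetricOn g U) (hx : x ∈ U) (hN : IsNormalAt g x)
  (hflat : IsConformallyFlatOn (liftedMetric a g) (U ×ˢ Set.univ))
include hg hx hN hflat

theorem exists_schouten_lift : ∃ S : Coord n × Coord n → Coord n × Coord n → ℝ,
    (∀ A B, S A B = S B A) ∧ ∀ u v w z,
      liftHess a g x u w v z + liftHess a g x v z u w - liftHess a g x u z v w
        - liftHess a g x v w u z
      = 2 * (S u w * liftedMetric a g (x, 0) v z + liftedMetric a g (x, 0) u w * S v z
        - S v w * liftedMetric a g (x, 0) u z - liftedMetric a g (x, 0) v w * S u z) := by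
  obtain ⟨W, hW, hpW, -, ⟨ι⟩⟩ := exists_coneImmersion hflat (p := (x, 0)) ⟨hx, trivial⟩
  have hs := ι.contDiffOn_metric hW
  obtain ⟨S, hS, hcurv⟩ := ι.exists_schouten hW hpW fun u w z =>
    dirDeriv_liftedMetric_eq_zero hg hx hW hpW hs hN u w z
  refine ⟨S, hS, fun u v w z => ?_⟩
  rw [← hcurv]
  unfold curvComb
  simp only [secondDeriv_liftedMetric hg hx hW hpW hs hN]

/-- Each term of the Kulkarni–Nomizu product contains the product of one of `u, v` with one of `w,
z`. With the first two orthogonal to the fibre and the last two vertical all these vanish, and what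
is left is `c₂(0)` times the curvature of `g` plus terms built from products of `g`. -/
theorem spaceFormAt_of_c₂_ne_zero (hc : a.c₂ 0 ≠ 0) : SpaceFormAt g x (curvatureConst₂ a) := by
  obtain ⟨S, -, hS⟩ := exists_schouten_lift hg hx hN hflat
  refine hN.spaceFormAt hg hx fun u v w z => ?_
  -- The value of `e` for which `(X, -eX)` is orthogonal to all vertical vectors at `(x, 0)`.
  obtain ⟨e, he⟩ : ∃ e, e = a.c₃ 0 / a.c₂ 0 := ⟨_, rfl⟩
  have hE : a.c₃ 0 = e * a.c₂ 0 := by rw [he]; field_simp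
  have h0 : ∀ X Z : Coord n, liftedMetric a g (x, 0) (X, -e • X) (0, Z) = 0 := fun X Z => by
    rw [liftedMetric_zero]
    simp only [form_zero_right, form_smul_left, hE]
    ring
  have h := hS (u, -e • u) (v, -e • v) (0, w) (0, z)
  rw [h0, h0, h0, h0] at h
  unfold liftHess fibreJet christoffelHess at h
  simp only [map_smul, map_zero, LinearMap.smul_apply, LinearMap.zero_apply, smul_eq_mul,
    form_smul_left, form_smul_right, form_zero_left, form_zero_right, hg.form_comm hx z,
    hg.form_comm hx w v, hg.form_comm hx w u, hg.form_comm hx v u,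
    hg.metricHess_comm_right hx _ _ z,
    hg.metricHess_comm_left hx v u, hg.metricHess_comm_right hx _ _ w v,
    hg.metricHess_comm_right hx _ _ w u] at h ⊢
  unfold curvatureConst₂
  rw [← he]
  field_simp
  linear_combination h

/-- Vertical vectors are now null, and the vectors `(X, -eX)` with `c₁(0) = 2 e c₃(0)` form another
totally null space. Four vectors of it kill the Kulkarni–Nomizu product, and the curvature of `g`
survives with the nonzero factor `-c₁(0)`. -/
theorem spaceFormAt_of_c₁_ne_zero (hc₂ : a.c₂ 0 = 0) (hc₃ : a.c₃ 0 ≠ 0) (hc₁ : a.c₁ 0 ≠ 0) :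
    SpaceFormAt g x (curvatureConst₁ a) := by
  obtain ⟨S, -, hS⟩ := exists_schouten_lift hg hx hN hflat
  refine hN.spaceFormAt hg hx fun u v w z => ?_
  obtain ⟨e, he⟩ : ∃ e, e = a.c₁ 0 / (2 * a.c₃ 0) := ⟨_, rfl⟩
  have hE : a.c₁ 0 = 2 * e * a.c₃ 0 := by rw [he]; field_simp
  have h0 : ∀ X Z : Coord n, liftedMetric a g (x, 0) (X, -e • X) (Z, -e • Z) = 0 := fun X Z => by
    rw [liftedMetric_zero]
    simp only [form_smul_left, form_smul_right, hE, hc₂]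
    ring
  have h := hS (u, -e • u) (v, -e • v) (w, -e • w) (z, -e • z)
  rw [h0, h0, h0, h0] at h
  unfold liftHess fibreJet christoffelHess at h
  simp only [map_smul, LinearMap.smul_apply, smul_eq_mul, form_smul_left, form_smul_right, hg.form_comm hx z,
    hg.form_comm hx w v, hg.form_comm hx w u, hg.form_comm hx v u,
    hg.metricHess_comm_left hx z, hg.metricHess_comm_right hx _ _ z,
    hg.metricHess_comm_left hx w v, hg.metricHess_comm_left hx w u,
    hg.metricHess_comm_left hx v u, hg.metricHess_comm_right hx _ _ w v,
    hg.metricHess_comm_right hx _ _ w u, hg.metricHess_comm_right hx _ _ v u, hc₂] at h ⊢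
  unfold curvatureConst₁
  rw [← he]
  field_simp
  rw [hE] at h ⊢
  linear_combination (-1) * h

/-- Horizontal and vertical vectors are both null, and no choice of null vectors isolates a
constant. Keeping one vertical argument leaves `S` on horizontal vectors, and the symmetries of the
curvature of `g` force `S` to be a multiple of `g`. -/
theorem exists_spaceFormAt_of_c₁_eq_zero (hc₂ : a.c₂ 0 = 0) (hc₃ : a.c₃ 0 ≠ 0)
    (hc₁ : a.c₁ 0 = 0) : ∃ c, SpaceFormAt g x c := by
  obtain ⟨S', hS', hcurv⟩ := exists_schouten_lift hg hx hN hflat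
  set S : Coord n → Coord n → ℝ := fun u v => S' (u, 0) (v, 0) with hSdef
  have hS : ∀ u v, S u v = S v u := fun u v => hS' _ _
  have key : ∀ u v w z, metricHess g x u w v z + metricHess g x v z u w - metricHess g x u z v w
      - metricHess g x v w u z = 2 * (S u w * form g x v z - S v w * form g x u z) := by
    intro u v w z
    have h := hcurv (u, 0) (v, 0) (w, 0) (0, z)
    unfold liftHess fibreJet christoffelHess at h
    simp only [liftedMetric_zero, map_zero, LinearMap.zero_apply, form_zero_left,
      form_zero_right, hc₁, hc₂] at h
    refine mul_left_cancel₀ hc₃ ?_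
    rw [hg.metricHess_comm_left hx u w, hg.metricHess_comm_left hx v w] at *
    simp only [hSdef]
    linear_combination h
  -- With `z = w` the curvature expression vanishes by skew-symmetry in its last two arguments.
  have h1 : ∀ u v w, S u w * form g x v w = S v w * form g x u w := fun u v w => by
    have h := key u v w w
    rw [hg.metricHess_comm_right hx v w u w] at h
    rw [hg.metricHess_comm_right hx v w w u, hg.metricHess_comm_right hx u w v w] at h
    linarith [key u v w w, key v u w w]
  have h2 : ∀ w, w ≠ 0 → ∀ u, S u w = S w w / form g x w w * form g x u w := fun w hw u => by
    have h3 := h1 u w w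
    have h4 := (hg.pos x hx w hw).ne'
    field_simp
    linarith
  have h3 : ∀ v w, v ≠ 0 → w ≠ 0 → form g x v w ≠ 0 →
      S v v / form g x v v = S w w / form g x w w := fun v w hv hw hvw => by
    have e1 := h2 w hw v
    have e2 := h2 v hv w
    rw [hS w v, hg.form_comm hx w v] at e2
    exact mul_right_cancel₀ hvw (e2.symm.trans e1)
  obtain ⟨μ, hμ⟩ : ∃ μ, ∀ u w v z,
      S u w * form g x v z = μ * form g x u w * form g x v z := by
    by_cases hE : ∃ e : Coord n, e ≠ 0
    · obtain ⟨e, he⟩ := hE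
      refine ⟨S e e / form g x e e, fun u w v z => ?_⟩
      congr 1
      -- The ratio agrees on non-orthogonal vectors; orthogonal ones are compared through `w + e`.
      have hw0 : ∀ w, w ≠ 0 → S w w / form g x w w = S e e / form g x e e := fun w hw => by
        by_cases hew : form g x w e = 0
        · have hwe : form g x e w = 0 := by rw [hg.form_comm hx]; exact hew
          have a1 : form g x w (w + e) ≠ 0 := by
            rw [form_add_right, hew, add_zero]; exact (hg.pos x hx w hw).ne'
          have a2 : form g x (w + e) e ≠ 0 := by
            rw [form_add_left, hew, zero_add]; exact (hg.pos x hx e he).ne'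
          have a3 : w + e ≠ 0 := fun h => a2 (by rw [h, form_zero_left])
          exact (h3 w (w + e) hw a3 a1).trans (h3 (w + e) e a3 he a2)
        · exact h3 w e hw he hew
      -- `S` is only known to be a symmetric function, not bilinear, so its values at the zero
      -- vector need a separate argument.
      by_cases hw : w = 0
      · by_cases hu : u = 0
        · subst hw hu
          have h4 := key 0 e 0 e
          simp only [map_zero, LinearMap.zero_apply, form_zero_left, mul_zero] at h4
          rw [form_zero_left, mul_zero]
          have h5 := (hg.pos x hx e he).ne'
          exact (mul_eq_zero.1 (show S 0 0 * form g x e e = 0 by linarith)).resolve_right h5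
        · rw [hw, form_zero_right, mul_zero, hS, h2 u hu, form_zero_left, mul_zero]
      · rw [h2 w hw, hw0 w hw]
    · push Not at hE
      exact ⟨0, fun u w v z => by rw [hE v, form_zero_left]; ring⟩
  refine ⟨-μ, hN.spaceFormAt hg hx fun u v w z => ?_⟩
  rw [key, hμ, hμ]
  ring

/-- Since `c₁(0) = 0`, horizontal vectors at `(x, 0)` are null, so the derivative of the curvature
expression of `G` on four of them vanishes in the fibre direction `(0, s)`. That derivative equals
`c₃(0)` times the derivative in the direction `s` of the expression for `g`. -/
theorem dirDeriv_curvComb_form_eq_zero (hc₃ : a.c₃ 0 ≠ 0) (hc₁ : a.c₁ 0 = 0)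
    (s u v w z : Coord n) : dirDeriv s (fun y => curvComb (form g) y u v w z) x = 0 := by
  obtain ⟨W, hW, hpW, hWU, ⟨ι⟩⟩ := exists_coneImmersion hflat (p := (x, 0)) ⟨hx, trivial⟩
  have hs := ι.contDiffOn_metric hW
  have hnull : ∀ v w : Coord n, liftedMetric a g (x, 0) (v, 0) (w, 0) = 0 := fun v w => by
    rw [liftedMetric_zero]
    simp [hc₁, form_zero_left, form_zero_right]
  have h0 := ι.dirDeriv_curvComb_eq_zero hW hpW
    (fun u w z => dirDeriv_liftedMetric_eq_zero hg hx hW hpW hs hN u w z)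
    (hnull u w) (hnull v z) (hnull u z) (hnull v w) (0, s)
  have hU := hg.isOpen
  set V : Set (Coord n) := {y | (y, (0 : Coord n)) ∈ W} with hVdef
  have hι : ∀ y : Coord n, DifferentiableAt ℝ (fun y : Coord n => (y, (0 : Coord n))) y :=
    fun y => by fun_prop
  have dι : ∀ y b : Coord n, dirDeriv b (fun y : Coord n => (y, (0 : Coord n))) y = (b, 0) := by
    intro y b
    unfold dirDeriv
    rw [DifferentiableAt.fderiv_prodMk differentiableAt_fun_id (differentiableAt_const _)]
    simp
  have hV : IsOpen V := hW.preimage (by fun_prop)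
  have hrestr : ∀ {f : Coord n × Coord n → ℝ}, ContDiffOn ℝ ∞ f W → ∀ b : Coord n, ∀ y ∈ V,
      dirDeriv (b, 0) f (y, 0) = dirDeriv b (fun y => f (y, 0)) y := by
    intro f hf b y hy
    rw [dirDeriv_comp (ψ := fun y : Coord n => (y, (0 : Coord n)))
      (differentiableAt_of_contDiffOn hW hf hy) (hι y), dι]
  -- Commute the fibre derivative to the inside, where on the zero section it is `c₃(0) ∂ₛ g`; the
  -- outer derivatives are tangent to the zero section, so they see only these values. Then commute
  -- back.
  have third : ∀ b c d e : Coord n,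
      dirDeriv (0, s) (fun q => secondDeriv (liftedMetric a g) q (b, 0) (c, 0) (d, 0) (e, 0)) (x, 0)
        = a.c₃ 0 * dirDeriv s (fun y => secondDeriv (form g) y b c d e) x := by
    intro b c d e
    set f : Coord n × Coord n → ℝ := fun p => liftedMetric a g p (d, 0) (e, 0) with hf
    have hfs : ContDiffOn ℝ ∞ f W := hs _ _
    have c1 : dirDeriv (0, s) (dirDeriv (b, 0) (dirDeriv (c, 0) f)) (x, 0)
        = dirDeriv (b, 0) (dirDeriv (c, 0) (dirDeriv (0, s) f)) (x, 0) := by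
      rw [dirDeriv_comm hW (contDiffOn_dirDeriv hW hfs _) hpW]
      exact dirDeriv_congr hW (fun q hq => dirDeriv_comm hW hfs hq _ _) hpW _
    have hks := contDiffOn_dirDeriv hW hfs (0, s)
    have c2 : dirDeriv (b, 0) (dirDeriv (c, 0) (dirDeriv (0, s) f)) (x, 0)
        = dirDeriv b (dirDeriv c (fun y => dirDeriv (0, s) f (y, 0))) x := by
      rw [hrestr (contDiffOn_dirDeriv hW hks _) b x hpW]
      exact dirDeriv_congr hV (fun y hy => hrestr hks c y hy) hpW b
    have hgs := hg.contDiffOn_form d e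
    have hgss := contDiffOn_dirDeriv hU hgs s
    have c3 : Set.EqOn (fun y => dirDeriv (0, s) f (y, 0))
        (fun y => a.c₃ 0 * dirDeriv s (fun y => form g y d e) y) V := fun y hy =>
      dirDeriv_liftedMetric_fibre hg (hWU hy).1 hW hy hs s d e
    have hVU : V ⊆ U := fun y hy => (hWU hy).1
    have c4 : dirDeriv b (dirDeriv c (fun y => dirDeriv (0, s) f (y, 0))) x
        = a.c₃ 0 * dirDeriv b (dirDeriv c (dirDeriv s (fun y => form g y d e))) x := by
      rw [dirDeriv_congr hV (eqOn_dirDeriv hV c3 c) hpW b,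
        ← dirDeriv_const_mul (differentiableAt_of_contDiffOn hU (contDiffOn_dirDeriv hU hgss c) hx)]
      exact dirDeriv_congr hU (fun y hy =>
        dirDeriv_const_mul (differentiableAt_of_contDiffOn hU hgss hy) _ _) hx b
    have c5 : dirDeriv b (dirDeriv c (dirDeriv s (fun y => form g y d e))) x
        = dirDeriv s (dirDeriv b (dirDeriv c (fun y => form g y d e))) x := by
      rw [dirDeriv_comm hU (contDiffOn_dirDeriv hU hgs c) hx s b]
      exact dirDeriv_congr hU (fun y hy => dirDeriv_comm hU hgs hy _ _) hx b
    change dirDeriv (0, s) (dirDeriv (b, 0) (dirDeriv (c, 0) f)) (x, 0) = _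
    rw [c1, c2, c4, c5]
    rfl
  have dG : ∀ b c d e : Coord n × Coord n,
      DifferentiableAt ℝ (fun q => secondDeriv (liftedMetric a g) q b c d e) (x, 0) :=
    fun b c d e => differentiableAt_of_contDiffOn hW
      (contDiffOn_dirDeriv hW (contDiffOn_dirDeriv hW (hs d e) c) b) hpW
  have dg : ∀ b c d e : Coord n,
      DifferentiableAt ℝ (fun q => secondDeriv (form g) q b c d e) x :=
    fun b c d e => differentiableAt_of_contDiffOn hU
      (contDiffOn_dirDeriv hU (contDiffOn_dirDeriv hU (hg.contDiffOn_form d e) c) b) hx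
  unfold curvComb at h0 ⊢
  rw [dirDeriv_sub (((dG _ _ _ _).fun_add (dG _ _ _ _)).fun_sub (dG _ _ _ _)) (dG _ _ _ _),
    dirDeriv_sub ((dG _ _ _ _).fun_add (dG _ _ _ _)) (dG _ _ _ _),
    dirDeriv_add (dG _ _ _ _) (dG _ _ _ _), third, third, third, third] at h0
  rw [dirDeriv_sub (((dg _ _ _ _).fun_add (dg _ _ _ _)).fun_sub (dg _ _ _ _)) (dg _ _ _ _),
    dirDeriv_sub ((dg _ _ _ _).fun_add (dg _ _ _ _)) (dg _ _ _ _),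
    dirDeriv_add (dg _ _ _ _) (dg _ _ _ _)]
  refine mul_left_cancel₀ hc₃ ?_
  linear_combination h0

end ConformallyFlatLift

/-! ### The derivative of a pointwise constant curvature -/

section LocalUniqueness

variable {n : ℕ} {g : Coord n → Matrix (Fin n) (Fin n) ℝ} {U : Set (Coord n)} {x : Coord n}

theorem spaceFormAt_zero_of_subsingleton [Subsingleton (Fin n)]
    (g : Coord n → Matrix (Fin n) (Fin n) ℝ) (x : Coord n) : SpaceFormAt g x 0 := by
  intro u v w
  have h : ∀ h k i j, riemann g x h k i j = 0 := fun h k i j => by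
    rw [Subsingleton.elim j i]
    simp [riemann]
  ext h'
  simp [curvatureVector, h]

theorem linearIndependent_single {i j : Fin n} (hij : i ≠ j) :
    LinearIndependent ℝ ![(EuclideanSpace.single i (1 : ℝ) : Coord n),
      EuclideanSpace.single j 1] := by
  rw [LinearIndependent.pair_iff]
  intro s t h
  have h1 := congrArg (fun v : Coord n => v i) h
  have h2 := congrArg (fun v : Coord n => v j) h
  simp only [PiLp.add_apply, PiLp.smul_apply, PiLp.single_apply, PiLp.zero_apply, smul_eq_mul] at h1 h2
  simp [hij, hij.symm] at h1 h2
  exact ⟨h1, h2⟩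

theorem hasFDerivAt_zero_of_dirDeriv {f : Coord n → ℝ} (hf : DifferentiableAt ℝ f x)
    (h : ∀ s, dirDeriv s f x = 0) : HasFDerivAt f (0 : Coord n →L[ℝ] ℝ) x := by
  have h1 : fderiv ℝ f x = 0 := ContinuousLinearMap.ext h
  rw [← h1]
  exact hf.hasFDerivAt

/-- Nothing is assumed on the regularity of `f`: on one coordinate plane it is a quotient of the
curvature by a Gram determinant, hence differentiable. At the centre of normal coordinates the Gram
determinant, the linear part of the curvature and the terms quadratic in the Christoffel symbols all
have zero derivative. -/
theorem IsNormalAt.hasFDerivAt_curvature [Nontrivial (Fin n)] (hN : IsNormalAt g x)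
    (hg : IsMetricOn g U) (hx : x ∈ U) {f : Coord n → ℝ} (hf : ∀ y ∈ U, SpaceFormAt g y (f y))
    (hK : ∀ s u v w z, dirDeriv s (fun y => curvComb (form g) y u v w z) x = 0) :
    HasFDerivAt f (0 : Coord n →L[ℝ] ℝ) x := by
  obtain ⟨i, j, hij⟩ := exists_pair_ne (Fin n)
  have hli := linearIndependent_single hij
  set u : Coord n := EuclideanSpace.single i 1
  set v : Coord n := EuclideanSpace.single j 1
  have hU := hg.isOpen
  set Q : Coord n → ℝ := fun y => form g y v v * form g y u u - form g y u v * form g y v u with hQ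
  set T : Coord n → ℝ := fun y => curvComb (form g) y u v v u
    + 2 * (form g y (christoffelL g y u v) (christoffelL g y v u)
        - form g y (christoffelL g y v v) (christoffelL g y u u)) with hT
  have hfT : ∀ y ∈ U, f y = T y * (2 * Q y)⁻¹ := fun y hy => by
    have h1 := hg.two_mul_form_curvatureVector hy u v v u
    rw [hf y hy, form_smul_left, form_sub_left, form_smul_left, form_smul_left] at h1
    have h2 := hg.gram_pos hy hli
    have h3 : Q y ≠ 0 := by
      have : Q y = form g y u u * form g y v v - form g y u v ^ 2 := by
        simp only [hQ]; rw [hg.form_comm hy v u]; ring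
      rw [this]; exact h2.ne'
    rw [hT]
    simp only
    rw [← h1, eq_mul_inv_iff_mul_eq₀ (by simpa using h3)]
    simp only [hQ]
    ring
  have dform : ∀ a b : Coord n, HasFDerivAt (fun y => form g y a b) (0 : Coord n →L[ℝ] ℝ) x :=
    fun a b => hasFDerivAt_zero_of_dirDeriv
      (differentiableAt_of_contDiffOn hU (hg.contDiffOn_form a b) hx) fun s => hN s a b
  have dQ : HasFDerivAt Q (0 : Coord n →L[ℝ] ℝ) x := by
    exact (((dform v v).mul (dform u u)).sub ((dform u v).mul (dform v u))).congr_fderiv (by simp)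
  have dK : HasFDerivAt (fun y => curvComb (form g) y u v v u) (0 : Coord n →L[ℝ] ℝ) x := by
    refine hasFDerivAt_zero_of_dirDeriv ?_ fun s => hK s u v v u
    have dg : ∀ b c d e : Coord n,
        DifferentiableAt ℝ (fun q => secondDeriv (form g) q b c d e) x :=
      fun b c d e => differentiableAt_of_contDiffOn hU
        (contDiffOn_dirDeriv hU (contDiffOn_dirDeriv hU (hg.contDiffOn_form d e) c) b) hx
    exact (((dg _ _ _ _).add (dg _ _ _ _)).sub (dg _ _ _ _)).sub (dg _ _ _ _)
  have dΓ : ∀ a b c d : Coord n, HasFDerivAt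
      (fun y => form g y (christoffelL g y a b) (christoffelL g y c d)) (0 : Coord n →L[ℝ] ℝ) x := by
    intro a b c d
    have h1 := fun a b => hg.contDiffOn_christoffelL_apply a b
    have hd := fun a b => differentiableAt_of_contDiffOn hU (h1 a b) hx
    have h2 : ContDiffOn ℝ ∞
        (fun y => form g y (christoffelL g y a b) (christoffelL g y c d)) U := by
      simp only [← formL_apply]
      exact (hg.contDiffOn_formL.clm_apply (h1 a b)).clm_apply (h1 c d)
    refine hasFDerivAt_zero_of_dirDeriv (differentiableAt_of_contDiffOn hU h2 hx) fun s => ?_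
    rw [hg.dirDeriv_form_comp (ψ := fun y => y) hx differentiableAt_id (hd a b) (hd c d)]
    simp only [hN.christoffelL_eq_zero hg hx, form_zero_left, form_zero_right, add_zero]
    exact dirDeriv_const _ _ _
  have dT : HasFDerivAt T (0 : Coord n →L[ℝ] ℝ) x := by
    exact (dK.add (((dΓ u v v u).sub (dΓ v v u u)).const_mul 2)).congr_fderiv (by simp)
  have hQx : 2 * Q x ≠ 0 := by
    have : Q x = form g x u u * form g x v v - form g x u v ^ 2 := by
      simp only [hQ]; rw [hg.form_comm hx v u]; ring
    rw [this]; simpa using (hg.gram_pos hx hli).ne'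
  have dQi : HasFDerivAt (fun y => (2 * Q y)⁻¹) (0 : Coord n →L[ℝ] ℝ) x := by
    have := (hasDerivAt_inv hQx).comp_hasFDerivAt x (dQ.const_mul 2)
    simpa [Function.comp_def] using this
  have := dT.mul dQi
  simp only [smul_zero, add_zero] at this
  refine HasFDerivAt.congr_of_eventuallyEq this ?_
  filter_upwards [hU.mem_nhds hx] with y hy using hfT y hy

end LocalUniqueness

/-! ### Metric matrices in charts of the manifold -/

section Charts

theorem contMDiff_tangentBundle_const {E : Type*} [NormedAddCommGroup E] [NormedSpace ℝ E] (v : E) :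
    ContMDiff 𝓘(ℝ, E) 𝓘(ℝ, E).tangent ∞ (fun x => (⟨x, v⟩ : TangentBundle 𝓘(ℝ, E) E)) :=
  contMDiff_vectorSpace_iff_contDiff.2 contDiff_const

variable {n : ℕ} {M : Type*} [TopologicalSpace M] [ChartedSpace (Coord n) M]
  [IsManifold (𝓡 n) ∞ M] {e e' : OpenPartialHomeomorph M (Coord n)} {x x' : Coord n}

theorem form_metricMatrix (g : SmoothMetric n M) (e : OpenPartialHomeomorph M (Coord n))
    (x v w : Coord n) : form (metricMatrix g e) x v w = g.inner (e.symm x)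
      (mfderiv (𝓡 n) (𝓡 n) e.symm x (v : Coord n)) (mfderiv (𝓡 n) (𝓡 n) e.symm x (w : Coord n)) := by
  set b : Coord n →L[ℝ] Coord n →L[ℝ] ℝ := g.inner (e.symm x) with hb
  set T : Coord n →L[ℝ] Coord n := mfderiv (𝓡 n) (𝓡 n) e.symm x with hT
  have hexp : ∀ v : Coord n, T v = ∑ i, v i • T (EuclideanSpace.single i 1) := fun v => by
    conv_lhs => rw [← (EuclideanSpace.basisFun (Fin n) ℝ).sum_repr v]
    simp
  change _ = b (T v) (T w)
  rw [hexp v, hexp w]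
  simp only [map_sum, map_smul, sum_apply, smul_apply, smul_eq_mul]
  unfold form
  rw [Finset.sum_comm]
  refine Finset.sum_congr rfl fun i _ => ?_
  rw [Finset.mul_sum]
  refine Finset.sum_congr rfl fun j _ => ?_
  change b (T _) (T _) * _ * _ = _
  ring

omit [IsManifold (𝓡 n) ∞ M] in
theorem mdifferentiable_chart (he : e ∈ IsManifold.maximalAtlas (𝓡 n) ∞ M) :
    e.MDifferentiable (𝓡 n) (𝓡 n) :=
  ⟨(contMDiffOn_of_mem_maximalAtlas he).mdifferentiableOn (by simp),
    (contMDiffOn_symm_of_mem_maximalAtlas he).mdifferentiableOn (by simp)⟩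

/-- The coordinate fields are the images of constant fields under the tangent map of the inverse
chart, so they are smooth sections, and the bundle metric applied to them is smooth. -/
theorem contDiffOn_metricMatrix (g : SmoothMetric n M)
    (he : e ∈ IsManifold.maximalAtlas (𝓡 n) ∞ M) (i j : Fin n) :
    ContDiffOn ℝ ∞ (fun x => metricMatrix g e x i j) e.target := by
  have hsymm := contMDiffOn_symm_of_mem_maximalAtlas he
  have hV : ∀ v : Coord n, ContMDiffOn (𝓡 n) (𝓡 n).tangent ∞
      (fun x => (⟨e.symm x, mfderiv (𝓡 n) (𝓡 n) e.symm x v⟩ : TangentBundle (𝓡 n) M))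
      e.target := by
    intro v
    have h1 := hsymm.contMDiffOn_tangentMapWithin (m := ∞) (by simp)
      e.open_target.uniqueMDiffOn
    have h2 := contMDiff_tangentBundle_const v
    refine (h1.comp h2.contMDiffOn fun x hx => hx).congr fun x hx => ?_
    simp only [Function.comp_apply, tangentMapWithin]
    rw [mfderivWithin_of_isOpen e.open_target hx]
  have hg := g.contMDiff.comp_contMDiffOn hsymm
  have := ContMDiffOn.clm_bundle_apply₂ (F₁ := Coord n) (F₂ := Coord n) (F₃ := ℝ)
    (E₃ := Bundle.Trivial M ℝ) hg (hV (EuclideanSpace.single i 1)) (hV (EuclideanSpace.single j 1))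
  rw [← contMDiffOn_iff_contDiffOn]
  intro x hx
  have h3 := this x hx
  rw [Bundle.contMDiffWithinAt_totalSpace] at h3
  have h4 := h3.2
  simp at h4
  exact h4

theorem isMetricOn_metricMatrix (g : SmoothMetric n M)
    (he : e ∈ IsManifold.maximalAtlas (𝓡 n) ∞ M) : IsMetricOn (metricMatrix g e) e.target where
  isOpen := e.open_target
  smooth := contDiffOn_metricMatrix g he
  symm x _ i j := g.symm _ _ _
  pos x hx v hv := by
    rw [form_metricMatrix]
    refine g.pos _ _ fun h0 => hv ?_
    have h1 := (mdifferentiable_chart he).comp_symm_deriv hx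
    have h2 := congrArg (fun L : Coord n →L[ℝ] Coord n => L v) h1
    have h3 : mfderiv (𝓡 n) (𝓡 n) e (e.symm x)
      (mfderiv (𝓡 n) (𝓡 n) e.symm x v) = v := h2
    rw [h0, map_zero] at h3
    exact h3.symm

theorem IsMetricOn.mono {g : Coord n → Matrix (Fin n) (Fin n) ℝ} {U V : Set (Coord n)}
    (hg : IsMetricOn g U) (hV : IsOpen V) (hVU : V ⊆ U) : IsMetricOn g V where
  isOpen := hV
  smooth i j := (hg.smooth i j).mono hVU
  symm x hx := hg.symm x (hVU hx)
  pos x hx := hg.pos x (hVU hx)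

/-- The isometry property is the chain rule for `e'.symm = e.symm ∘ (e ∘ e'.symm)`; surjectivity of
the derivative comes from the opposite transition map. -/
theorem isChange_charts (g : SmoothMetric n M) (he : e ∈ IsManifold.maximalAtlas (𝓡 n) ∞ M)
    (he' : e' ∈ IsManifold.maximalAtlas (𝓡 n) ∞ M) :
    IsChange (metricMatrix g e') (metricMatrix g e) (e'.symm.trans e).source e.target
      (fun x => e (e'.symm x)) := by
  have smooth : ∀ {e e' : OpenPartialHomeomorph M (Coord n)},
      e ∈ IsManifold.maximalAtlas (𝓡 n) ∞ M → e' ∈ IsManifold.maximalAtlas (𝓡 n) ∞ M →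
      ContDiffOn ℝ ∞ (fun x => e (e'.symm x)) (e'.symm.trans e).source := by
    intro e e' he he'
    have h1 := contMDiffOn_of_mem_contDiffGroupoid
      (StructureGroupoid.compatible_of_mem_maximalAtlas he' he)
    rw [contMDiffOn_iff_contDiffOn] at h1
    exact h1
  have hS := (e'.symm.trans e).open_source
  have hmem : ∀ x ∈ (e'.symm.trans e).source, x ∈ e'.target ∧ e'.symm x ∈ e.source := fun x hx => by
    simpa using hx
  refine ⟨smooth he he', fun x hx => e.map_source (hmem x hx).2, fun x hx u v => ?_, fun x hx y => ?_⟩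
  · obtain ⟨hx1, hx2⟩ := hmem x hx
    have hd := differentiableAt_of_contDiffOn hS (smooth he he') hx
    have hds : MDifferentiableAt (𝓡 n) (𝓡 n) e.symm (e (e'.symm x)) :=
      (mdifferentiable_chart he).mdifferentiableAt_symm (e.map_source hx2)
    have hcomp : mfderiv (𝓡 n) (𝓡 n) e'.symm x
        = (mfderiv (𝓡 n) (𝓡 n) e.symm (e (e'.symm x))).comp
          (mfderiv (𝓡 n) (𝓡 n) (fun x => e (e'.symm x)) x) := by
      rw [← mfderiv_comp x hds hd.mdifferentiableAt]
      refine Filter.EventuallyEq.mfderiv_eq ?_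
      filter_upwards [hS.mem_nhds hx] with y hy
      exact (e.left_inv (hmem y hy).2).symm
    rw [form_metricMatrix, form_metricMatrix, e.left_inv hx2, hcomp, mfderiv_eq_fderiv]
    rfl
  · obtain ⟨hx1, hx2⟩ := hmem x hx
    have hy2 : e (e'.symm x) ∈ (e.symm.trans e').source := by
      simp [e.map_source hx2, e.left_inv hx2, e'.map_target hx1]
    have hd := (differentiableAt_of_contDiffOn hS (smooth he he') hx).hasFDerivAt
    have hd' := (differentiableAt_of_contDiffOn (e.symm.trans e').open_source (smooth he' he)
      hy2).hasFDerivAt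
    have hx3 : e' (e.symm (e (e'.symm x))) = x := by rw [e.left_inv hx2, e'.right_inv hx1]
    refine ⟨fderiv ℝ (fun x => e' (e.symm x)) (e (e'.symm x)) y, ?_⟩
    rw [← hx3] at hd
    have h3 := hd.comp (e (e'.symm x)) hd'
    have h4 : HasFDerivAt ((fun x => e (e'.symm x)) ∘ fun x => e' (e.symm x))
        (ContinuousLinearMap.id ℝ (Coord n)) (e (e'.symm x)) := by
      refine (hasFDerivAt_id _).congr_of_eventuallyEq ?_
      filter_upwards [(e.symm.trans e').open_source.mem_nhds hy2] with y hy
      have hy' : y ∈ e.target ∧ e.symm y ∈ e'.source := by simpa using hy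
      simp [e'.left_inv hy'.2, e.right_inv hy'.1]
    have h5 := congrArg (fun L : Coord n →L[ℝ] Coord n => L y) (h3.unique h4)
    simp only [hx3] at h5
    exact h5

theorem spaceFormAt_of_chart (g : SmoothMetric n M) (he : e ∈ IsManifold.maximalAtlas (𝓡 n) ∞ M)
    (he' : e' ∈ IsManifold.maximalAtlas (𝓡 n) ∞ M) (hx : x ∈ e.target) (hx' : x' ∈ e'.target)
    (h : e'.symm x' = e.symm x) {c : ℝ} (hc : SpaceFormAt (metricMatrix g e') x' c) :
    SpaceFormAt (metricMatrix g e) x c := by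
  have hmem : x' ∈ (e'.symm.trans e).source := by simp [hx', h, e.map_target hx]
  have h1 := (isChange_charts g he he').spaceFormAt
    ((isMetricOn_metricMatrix g he').mono (e'.symm.trans e).open_source fun y hy => by
      simp at hy; exact hy.1) (isMetricOn_metricMatrix g he) hmem hc
  simpa only [h, e.right_inv hx] using h1

end Charts

/-! ### Charts that are normal to first order at a given point -/

section NormalCharts

theorem exists_openPartialHomeomorph {F : Type*} [NormedAddCommGroup F] [NormedSpace ℝ F]
    [CompleteSpace F] {f : F → F} (hf : ContDiff ℝ ∞ f) {p : F}
    (hp : HasFDerivAt f (ContinuousLinearMap.id ℝ F) p) :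
    ∃ φ : OpenPartialHomeomorph F F, (∀ z, φ z = f z) ∧ p ∈ φ.source ∧
      ContDiffOn ℝ ∞ φ.symm φ.target := by
  have hp' : HasFDerivAt f ((ContinuousLinearEquiv.refl ℝ F : F ≃L[ℝ] F) : F →L[ℝ] F) p := hp
  set φ₀ := hf.contDiffAt.toOpenPartialHomeomorph f hp' (by simp) with hφ₀
  have hcoe : ∀ z, φ₀ z = f z := fun z => by
    rw [hφ₀, ContDiffAt.toOpenPartialHomeomorph_coe]
  set s : Set F := fderiv ℝ f ⁻¹' Set.range ((↑) : (F ≃L[ℝ] F) → F →L[ℝ] F) with hs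
  have hsopen : IsOpen s :=
    ContinuousLinearEquiv.isOpen.preimage (hf.continuous_fderiv (by simp))
  have hps : p ∈ s := ⟨ContinuousLinearEquiv.refl ℝ F, hp'.fderiv.symm⟩
  -- Restricting to the open set where the derivative is invertible makes the inverse smooth on its
  -- whole domain, not only at the image of `p`.
  refine ⟨φ₀.restrOpen s hsopen, hcoe, ?_, ?_⟩
  · rw [OpenPartialHomeomorph.restrOpen_source]
    exact ⟨ContDiffAt.mem_toOpenPartialHomeomorph_source hf.contDiffAt hp' (by simp), hps⟩
  · intro y hy
    have h1 := (φ₀.restrOpen s hsopen).map_target hy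
    rw [OpenPartialHomeomorph.restrOpen_source] at h1
    obtain ⟨L, hL⟩ := h1.2
    refine ((φ₀.restrOpen s hsopen).contDiffAt_symm (f₀' := L) hy ?_ ?_).contDiffWithinAt
    · rw [hL]
      exact ((hf.differentiable (by simp)) _).hasFDerivAt.congr_of_eventuallyEq
        (Eventually.of_forall hcoe)
    · exact hf.contDiffAt.congr_of_eventuallyEq (Eventually.of_forall hcoe)

variable {n : ℕ} {M : Type*} [TopologicalSpace M] [ChartedSpace (Coord n) M]
  [IsManifold (𝓡 n) ∞ M] {e : OpenPartialHomeomorph M (Coord n)} {x : Coord n}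

omit [IsManifold (𝓡 n) ∞ M] in
theorem trans_mem_maximalAtlas (he : e ∈ IsManifold.maximalAtlas (𝓡 n) ∞ M)
    {φ : OpenPartialHomeomorph (Coord n) (Coord n)} (hφ : φ ∈ contDiffGroupoid ∞ (𝓡 n)) :
    e.trans φ ∈ IsManifold.maximalAtlas (𝓡 n) ∞ M := by
  intro c hc
  obtain ⟨h1, h2⟩ := he c hc
  refine ⟨?_, ?_⟩
  · rw [OpenPartialHomeomorph.trans_symm_eq_symm_trans_symm, OpenPartialHomeomorph.trans_assoc]
    exact StructureGroupoid.trans _ (StructureGroupoid.symm _ hφ) h1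
  · rw [← OpenPartialHomeomorph.trans_assoc]
    exact StructureGroupoid.trans _ h2 hφ

theorem exists_normal_chart (g : SmoothMetric n M) (he : e ∈ IsManifold.maximalAtlas (𝓡 n) ∞ M)
    (hx : x ∈ e.target) : ∃ e' ∈ IsManifold.maximalAtlas (𝓡 n) ∞ M, ∃ x' ∈ e'.target,
      e'.symm x' = e.symm x ∧ IsNormalAt (metricMatrix g e') x' := by
  have hg := isMetricOn_metricMatrix g he
  set Γ := christoffelL (metricMatrix g e) x with hΓ
  have hΓs : ∀ u v, Γ u v = Γ v u := hg.christoffelL_comm hx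
  -- The new coordinates are `z`, with `f` giving the old ones. The quadratic term is chosen so that
  -- the second derivative `-Γ` of `f` cancels the Christoffel symbols in the transformation law at
  -- 0, where the first derivative is the identity.
  set f : Coord n → Coord n := fun z => x + z - (1 / 2 : ℝ) • Γ z z with hf
  have hΓd : ∀ z, DifferentiableAt ℝ (fun z => Γ z z) z := fun z =>
    Γ.differentiableAt.clm_apply differentiableAt_id
  have hfs : ContDiff ℝ ∞ f :=
    (contDiff_const.add contDiff_id).sub
      ((Γ.contDiff.clm_apply contDiff_fun_id).const_smul (1 / 2 : ℝ))
  have df : ∀ z v, dirDeriv v f z = v - Γ z v := by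
    intro z v
    have h1 : dirDeriv v (fun z => Γ z z) z = Γ v z + Γ z v := by
      rw [dirDeriv_bilin Γ differentiableAt_fun_id differentiableAt_fun_id]
      simp [dirDeriv]
    have h2 : dirDeriv v (fun z : Coord n => x + z) z = v := by
      unfold dirDeriv
      rw [fderiv_const_add (f := fun z : Coord n => z), fderiv_fun_id]
      rfl
    rw [hf, dirDeriv_sub (show DifferentiableAt ℝ (fun z => x + z) z by fun_prop)
      (show DifferentiableAt ℝ (fun z => (1 / 2 : ℝ) • Γ z z) z from (hΓd z).fun_const_smul _), h2]
    have h3 : dirDeriv v (fun z => (1 / 2 : ℝ) • Γ z z) z = (1 / 2 : ℝ) • (Γ v z + Γ z v) := by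
      rw [← h1]
      unfold dirDeriv
      rw [fderiv_fun_const_smul (hΓd z)]; rfl
    rw [h3, hΓs v z]
    module
  have hf0 : HasFDerivAt f (ContinuousLinearMap.id ℝ (Coord n)) 0 := by
    have h1 := ((hfs.differentiable (by simp)) 0).hasFDerivAt
    have h2 : fderiv ℝ f 0 = ContinuousLinearMap.id ℝ (Coord n) := by
      refine ContinuousLinearMap.ext fun v => ?_
      have := df 0 v
      rw [map_zero] at this
      simpa [dirDeriv] using this
    rwa [h2] at h1
  obtain ⟨φ, hφf, h0, hφs⟩ := exists_openPartialHomeomorph hfs hf0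
  have hφfun : (φ : Coord n → Coord n) = f := funext hφf
  have hφmem : φ ∈ contDiffGroupoid ∞ (𝓡 n) := by
    rw [contDiffGroupoid, mem_groupoid_of_pregroupoid]
    refine ⟨?_, ?_⟩
    · simp only [contDiffPregroupoid, hφfun]
      simpa using hfs.contDiffOn
    · simp only [contDiffPregroupoid]
      simpa using hφs
  have hf00 : φ 0 = x := by rw [hφf, hf]; simp
  refine ⟨e.trans φ.symm, trans_mem_maximalAtlas he (StructureGroupoid.symm _ hφmem), 0, ?_, ?_, ?_⟩
  · simp [h0, hf00, hx]
  · simp [hf00]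
  · have he' := trans_mem_maximalAtlas he (StructureGroupoid.symm _ hφmem)
    set e' := e.trans φ.symm with he'def
    have hch := isChange_charts g he he'
    set S := (e'.symm.trans e).source with hS
    have hSo : IsOpen S := (e'.symm.trans e).open_source
    have h0S : (0 : Coord n) ∈ S := by simp [hS, he'def, h0, hf00, hx, e.map_target hx]
    have hST : ∀ y ∈ S, y ∈ e'.target := fun y hy => by
      simp only [hS, OpenPartialHomeomorph.trans_source, OpenPartialHomeomorph.symm_source] at hy
      exact hy.1
    have hψf : Set.EqOn (fun y => e (e'.symm y)) f S := fun y hy => by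
      have : y ∈ φ.source ∧ φ y ∈ e.target := by
        have := hST y hy
        simpa [he'def] using this
      simpa [he'def, hφf] using e.right_inv this.2
    have hg' := (isMetricOn_metricMatrix g he').mono hSo hST
    have hΓ' : ∀ u v, christoffelL (metricMatrix g e') 0 u v = 0 := by
      intro u v
      have h1 := hch.dirDeriv_christoffelL hg' hg h0S u v
      rw [dirDeriv_congr hSo hψf h0S, dirDeriv_congr hSo hψf h0S, dirDeriv_congr hSo hψf h0S,
        dirDeriv_congr hSo (eqOn_dirDeriv hSo hψf v) h0S, df, df, df] at h1
      have h2 : dirDeriv u (dirDeriv v f) 0 = - Γ u v := by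
        have : dirDeriv v f = fun z => v - Γ z v := funext fun z => df z v
        rw [this, dirDeriv_sub (differentiableAt_const _)
          (Γ.differentiableAt.clm_apply (differentiableAt_const v)), dirDeriv_const,
          dirDeriv_bilin Γ differentiableAt_fun_id (differentiableAt_const v), dirDeriv_const]
        simp [dirDeriv]
      have h3 : e (e'.symm 0) = x := by
        have := hψf h0S
        simpa [hf] using this
      rw [h2, h3] at h1
      simpa [← hΓ] using h1
    intro u v w
    rw [hg'.dirDeriv_form_eq h0S, hΓ', hΓ', form_zero_left, form_zero_right, add_zero]

end NormalCharts

/-! ### From pointwise to global constant curvature -/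

section Main

variable {n : ℕ} {M : Type*} [TopologicalSpace M] [ChartedSpace (Coord n) M]
  [IsManifold (𝓡 n) ∞ M]

/-- If `c₂(0) = c₃(0) = 0`, vertical vectors at a zero vector lie in the kernel of `G`. -/
theorem c₃_ne_zero [Nontrivial (Fin n)] {a : Coefficients}
    {g : Coord n → Matrix (Fin n) (Fin n) ℝ} {D : Set (Coord n × Coord n)} {x : Coord n}
    (hG : IsNondegenerateOn (liftedMetric a g) D) (hx : (x, 0) ∈ D) (hc₂ : a.c₂ 0 = 0) :
    a.c₃ 0 ≠ 0 := by
  intro hc₃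
  obtain ⟨i, -⟩ := exists_pair_ne (Fin n)
  have h := hG _ hx (0, EuclideanSpace.single i 1) fun Y => by
    rw [liftedMetric_zero, hc₂, hc₃, form_zero_left]
    ring
  have h1 := congrArg (fun X : Coord n × Coord n => X.2 i) h
  simp at h1

/-- A function with zero derivative in charts is locally constant, because its level sets within a
chart are open; connectedness finishes. -/
theorem exists_eq_of_hasFDerivAt_charts [ConnectedSpace M] {K : M → ℝ}
    (hK : ∀ e ∈ IsManifold.maximalAtlas (𝓡 n) ∞ M, ∀ x ∈ e.target,
      HasFDerivAt (fun y => K (e.symm y)) (0 : Coord n →L[ℝ] ℝ) x) : ∃ c, ∀ p, K p = c := by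
  have hloc : IsLocallyConstant K := by
    rw [IsLocallyConstant.iff_eventually_eq]
    intro p
    set e := chartAt (Coord n) p
    have he : e ∈ IsManifold.maximalAtlas (𝓡 n) ∞ M := IsManifold.chart_mem_maximalAtlas p
    have hp : p ∈ e.source := mem_chart_source _ p
    have hS := e.open_target.isOpen_inter_preimage_of_fderiv_eq_zero
      (fun x hx => (hK e he x hx).differentiableAt.differentiableWithinAt)
      (fun x hx => (hK e he x hx).fderiv) {K p}
    have hpS : e p ∈ e.target ∩ (fun y => K (e.symm y)) ⁻¹' {K p} :=
      ⟨e.map_source hp, by simp [e.left_inv hp]⟩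
    filter_upwards [e.open_source.mem_nhds hp,
      (e.continuousAt hp).preimage_mem_nhds (hS.mem_nhds hpS)] with q hq hqS
    simpa [e.left_inv hq] using hqS.2
  obtain ⟨p₀⟩ := (inferInstance : Nonempty M)
  exact ⟨K p₀, fun p => hloc.apply_eq_of_preconnectedSpace p p₀⟩

theorem exists_spaceFormAt_charts [ConnectedSpace M] (g : SmoothMetric n M) {a : Coefficients}
    (hG : LiftNondegenerate a g) (hflat : LiftConformallyFlat a g) :
    ∃ c : ℝ, ∀ e ∈ IsManifold.maximalAtlas (𝓡 n) ∞ M, ∀ x ∈ e.target,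
      SpaceFormAt (metricMatrix g e) x c := by
  rcases subsingleton_or_nontrivial (Fin n) with _ | _
  · exact ⟨0, fun e _ x _ => spaceFormAt_zero_of_subsingleton _ _⟩
  have hc₃ : a.c₂ 0 = 0 → a.c₃ 0 ≠ 0 := fun hc₂ => by
    obtain ⟨p⟩ := (inferInstance : Nonempty M)
    exact c₃_ne_zero (hG _ (IsManifold.chart_mem_maximalAtlas p))
      (x := chartAt (Coord n) p p) ⟨mem_chart_target _ p, trivial⟩ hc₂
  by_cases hc₂ : a.c₂ 0 = 0
  swap
  · refine ⟨curvatureConst₂ a, fun e he x hx => ?_⟩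
    obtain ⟨e', he', x', hx', h, hN⟩ := exists_normal_chart g he hx
    exact spaceFormAt_of_chart g he he' hx hx' h
      (spaceFormAt_of_c₂_ne_zero (isMetricOn_metricMatrix g he') hx' hN (hflat e' he') hc₂)
  by_cases hc₁ : a.c₁ 0 = 0
  swap
  · refine ⟨curvatureConst₁ a, fun e he x hx => ?_⟩
    obtain ⟨e', he', x', hx', h, hN⟩ := exists_normal_chart g he hx
    exact spaceFormAt_of_chart g he he' hx hx' h (spaceFormAt_of_c₁_ne_zero
      (isMetricOn_metricMatrix g he') hx' hN (hflat e' he') hc₂ (hc₃ hc₂) hc₁)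
  have hpt : ∀ p : M, ∃ c, ∀ e ∈ IsManifold.maximalAtlas (𝓡 n) ∞ M, ∀ x ∈ e.target,
      e.symm x = p → SpaceFormAt (metricMatrix g e) x c := fun p => by
    obtain ⟨e', he', x', hx', h, hN⟩ := exists_normal_chart g
      (IsManifold.chart_mem_maximalAtlas p) (mem_chart_target (Coord n) p)
    rw [(chartAt (Coord n) p).left_inv (mem_chart_source _ p)] at h
    obtain ⟨c, hc⟩ := exists_spaceFormAt_of_c₁_eq_zero (isMetricOn_metricMatrix g he') hx' hN
      (hflat e' he') hc₂ (hc₃ hc₂) hc₁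
    exact ⟨c, fun e he x hx hxp => spaceFormAt_of_chart g he he' hx hx' (h.trans hxp.symm) hc⟩
  choose K hK using hpt
  have hKe : ∀ e ∈ IsManifold.maximalAtlas (𝓡 n) ∞ M, ∀ x ∈ e.target,
      SpaceFormAt (metricMatrix g e) x (K (e.symm x)) := fun e he x hx => hK _ e he x hx rfl
  obtain ⟨c, hc⟩ := exists_eq_of_hasFDerivAt_charts (K := K) fun e he x hx => by
    -- The derivative of `K` is known to vanish only at the centre of a normal chart, so each point
    -- uses its own one and the chain rule carries the result to the chart `e`.
    obtain ⟨e', he', x', hx', h, hN⟩ := exists_normal_chart g he hx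
    have hg' := isMetricOn_metricMatrix g he'
    have hd := hN.hasFDerivAt_curvature hg' hx' (hKe e' he') fun s u v w z =>
      dirDeriv_curvComb_form_eq_zero hg' hx' hN (hflat e' he') (hc₃ hc₂) hc₁ s u v w z
    have hsrc : e.symm x ∈ e'.source := h ▸ e'.map_target hx'
    have hxS : x ∈ (e.symm.trans e').source := by simp [hx, hsrc]
    have hS := (e.symm.trans e').open_source
    have hx'e : e' (e.symm x) = x' := by rw [← h, e'.right_inv hx']
    rw [← hx'e] at hd
    have h1 := hd.comp x
      (differentiableAt_of_contDiffOn hS (isChange_charts g he' he).smooth hxS).hasFDerivAt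
    rw [ContinuousLinearMap.zero_comp] at h1
    refine h1.congr_of_eventuallyEq ?_
    filter_upwards [hS.mem_nhds hxS] with y hy
    have hy' : y ∈ e.target ∧ e.symm y ∈ e'.source := by simpa using hy
    simp [e'.left_inv hy'.2]
  exact ⟨c, fun e he x hx => hc (e.symm x) ▸ hKe e he x hx⟩

end Main

end NaturalLift

end

theorem mainTheorem2 {n : ℕ} {M : Type*} [TopologicalSpace M] [ConnectedSpace M]
    [ChartedSpace (NaturalLift.Coord n) M] [IsManifold (𝓡 n) ∞ M]
    (g : NaturalLift.SmoothMetric n M) (a : NaturalLift.Coefficients)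
    (hG : NaturalLift.LiftNondegenerate a g)
    (hflat : NaturalLift.LiftConformallyFlat a g) :
    ∃ c : ℝ, NaturalLift.HasConstantSectionalCurvature g c ∧
      NaturalLift.HasSpaceFormCurvature g c := by
  obtain ⟨c, hc⟩ := NaturalLift.exists_spaceFormAt_charts g hG hflat
  exact ⟨c, fun e he x hx v w hvw => (hc e he x hx).sectionalCurvature_eq
    (NaturalLift.isMetricOn_metricMatrix g he) hx hvw, fun e he x hx => (hc e he x hx).riemann_eq⟩
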